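/- Let $G$ be a compact, connected, semisimple Lie group with center $Z(G)$, and put $2Z(G)=\{z^2 : z\in Z(G)\}$. Let $\Sigma$ be a closed connected nonorientable surface, i.e. $\Sigma=\Sigma_\ell\,\sharp\,\mathbb{RP}^2$ (Case 1) or $\Sigma=\Sigma_\ell\,\sharp\,\text{Klein bottle}$ (Case 2), where $\Sigma_\ell$ is the closed orientable surface of genus $\ell\ge 0$, and let $\tilde\Sigma$ be its orientable double cover. The moduli spaces of flat $G$-connections are described by holonomies. Write $V=(a_1,b_1,\dots,a_\ell,b_\ell)\in G^{2\ell}$ in Case 1 and $V=(a_1,b_1,\dots,a_\ell,b_\ell,d)\in G^{2\ell+1}$ in Case 2, let $c\in G$, write $V',c'$ similarly, and let $R\big((V,c),(V',c')\big)$ be the relation $$\prod_{i=1}^{\ell}[a_i,b_i]=c\,c'\quad\text{(Case 1)},\qquad \prod_{i=1}^{\ell}[a_i,b_i]=c\,d'\,c^{-1}d\quad\text{(Case 2)}.$$ The moduli space for $\Sigma$ is $$\mathcal M=\{(V,c) : R((V,c),(V,c))\}/G,$$ where $G$ acts by simultaneous conjugation. The moduli space for $\tilde\Sigma$ is $$\tilde{\mathcal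 M}=M/(G\times G),\qquad M=\{(V,c,V',c') : R((V,c),(V',c'))\text{ and }R((V',c'),(V,c))\},$$ where $(g,h)\cdot(V,c,V',c')=(gVg^{-1},\,gch^{-1},\,hV'h^{-1},\,hc'g^{-1})$. The covering involution induces $\tau[(V,c,V',c')]=[(V',c',V,c)]$ on $\tilde{\mathcal M}$, and the natural map is $$I:\mathcal M\to\tilde{\mathcal M}^{\tau},\qquad I[(V,c)]=[(V,c,V,c)].$$ A point of $M$ is called generic if its stabilizer in $G\times G$ is the diagonally embedded center $\{(z,z):z\in Z(G)\}$. The smooth part of $\tilde{\mathcal M}^\tau$ is the set of those classes in $\tilde{\mathcal M}^\tau$ that are represented by generic points, and the smooth part of $\mathcal M$ is the set of classes $[(V,c)]$ with $(V,c,V,c)$ generic. A real function on either smooth part is called smooth if its pull-back to the corresponding set of tuples is locally the restriction of a smooth function on the ambient power of $G$. Then: 1. $Z(G)$ is finite, and $I$ is $|Z(G)/2Z(G)|$-to-one on the smooth part: for every $q$ in the smooth part of $\mathcal M$, the fiber $I^{-1}(I(q))$ has exactly $|Z(G)/2Z(G)|$ elements. 2. If $\ell\ge 1$ (i.e. $\Sigma$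 is neither $\mathbb{RP}^2$ nor the Klein bottle), then $I$ restricts to an isomorphism from the smooth part of $\mathcal M$ onto the smooth part of $\tilde{\mathcal M}^\tau$ (that is, to a homeomorphism under which the smooth functions on the two sides correspond) if and only if $|Z(G)|$ is odd. -/

import Mathlib

open scoped Manifold ContDiff

/-- The Lie bracket on the Lie algebra of a smooth Lie group needs `C^3` regularity only. -/
instance instLEInftyMinSmoothness : ENat.LEInfty (minSmoothness ℝ 3) :=
  ⟨by rw [minSmoothness_of_isRCLikeNormedField]; exact ENat.LEInfty.out⟩

/-- The topological types of closed connected nonorientable surfaces: `projective l` is the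
connected sum of the closed orientable surface of genus `l` with the real projective plane, and
`klein l` its connected sum with the Klein bottle. -/
inductive NonorientableSurface : Type
  | projective (l : ℕ)
  | klein (l : ℕ)

namespace NonorientableSurface

/-- The genus `l` of the orientable summand. -/
def handles : NonorientableSurface → ℕ
  | projective l => l
  | klein l => l

/-- The number of additional loops `D` : one for a Klein bottle summand, none otherwise. -/
def extraLoops : NonorientableSurface → ℕ
  | projective _ => 0
  | klein _ => 1

/-- Indices of the loops `A_1, …, A_l`, `B_1, …, B_l` (and `D` for a Klein bottle summand). -/
abbrev LoopIndex (S : NonorientableSurface) : Type :=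
  (Fin S.handles ⊕ Fin S.handles) ⊕ Fin S.extraLoops

end NonorientableSurface

/-- Holonomies `(V, c)`: the first component `V` lists the holonomies `a_i`, `b_i` (and `d`) of
the loops at one base point, the second one is the holonomy `c` along the remaining arc `C`. -/
abbrev Holonomy (S : NonorientableSurface) (G : Type*) : Type _ := (S.LoopIndex → G) × G

namespace Holonomy

variable {S : NonorientableSurface} {G : Type*} [Group G]

/-- The holonomy `a_i`. -/
def a (x : Holonomy S G) (i : Fin S.handles) : G := x.1 (Sum.inl (Sum.inl i))

/-- The holonomy `b_i`. -/
def b (x : Holonomy S G) (i : Fin S.handles) : G := x.1 (Sum.inl (Sum.inr i))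

/-- The holonomy `c`. -/
def c (x : Holonomy S G) : G := x.2

/-- The holonomy `d`, in the case of a Klein bottle summand. -/
def d {l : ℕ} (x : Holonomy (.klein l) G) : G := x.1 (Sum.inr (0 : Fin 1))

/-- The ordered product of commutators `[a_1, b_1] ⋯ [a_l, b_l]`, where
`[a, b] = a b a⁻¹ b⁻¹`. -/
def commProd (x : Holonomy S G) : G :=
  (List.ofFn fun i => x.a i * x.b i * (x.a i)⁻¹ * (x.b i)⁻¹).prod

/-- The flatness relation along the 2-cell at the base point of `x`, where `y` contains the
holonomies at the other base point:
`∏ [a_i, b_i] = c c'`, respectively `∏ [a_i, b_i] = c d' c⁻¹ d`. -/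
def FaceRel : {S : NonorientableSurface} → Holonomy S G → Holonomy S G → Prop
  | .projective _, x, y => x.commProd = x.c * y.c
  | .klein _, x, y => x.commProd = x.c * y.d * x.c⁻¹ * x.d

/-- Gauge transformation with value `g` at the base point of the loops and `h` at the end point
of the arc: `(V, c) ↦ (g V g⁻¹, g c h⁻¹)`. -/
def gauge (g h : G) (x : Holonomy S G) : Holonomy S G :=
  (fun i => g * x.1 i * g⁻¹, g * x.2 * h⁻¹)

theorem gauge_one (x : Holonomy S G) : gauge 1 1 x = x := by
  simp [gauge]

theorem gauge_mul (g g' h h' : G) (x : Holonomy S G) :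
    gauge (g * g') (h * h') x = gauge g h (gauge g' h' x) := by
  simp [gauge, mul_assoc]

theorem commProd_gauge (g h : G) (x : Holonomy S G) :
    (gauge g h x).commProd = g * x.commProd * g⁻¹ := by
  have key : ∀ u : G, MulAut.conj g u = g * u * g⁻¹ := fun u => rfl
  rw [commProd, commProd, ← key, map_list_prod, List.map_ofFn]
  congr 2
  funext i
  simp [Function.comp, gauge, a, b, mul_assoc]

theorem FaceRel.gauge {x y : Holonomy S G} (hxy : FaceRel x y) (g h : G) :
    FaceRel (gauge g h x) (gauge h g y) := by
  cases S with
  | projective l =>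
    simp only [FaceRel, commProd_gauge] at hxy ⊢
    rw [hxy]
    simp [Holonomy.gauge, c, mul_assoc]
  | klein l =>
    simp only [FaceRel, commProd_gauge] at hxy ⊢
    rw [hxy]
    simp [Holonomy.gauge, c, d, mul_assoc]

end Holonomy

/-- Flat connections on the nonorientable surface `S`, up to based gauge transformations: tuples
`(V, c)` with `∏ [a_i, b_i] = c²`, respectively `∏ [a_i, b_i] = c d c⁻¹ d`. -/
def FlatBase (S : NonorientableSurface) (G : Type*) [Group G] : Type _ :=
  {x : Holonomy S G // x.FaceRel x}

/-- Flat connections on the orientable double cover of `S`, up to gauge transformations that are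
trivial at the two points over the base point: tuples `(V, c, V', c')` that satisfy the relation of
either 2-cell. -/
def FlatCover (S : NonorientableSurface) (G : Type*) [Group G] : Type _ :=
  {p : Holonomy S G × Holonomy S G // p.1.FaceRel p.2 ∧ p.2.FaceRel p.1}

section Moduli

variable (S : NonorientableSurface) (G : Type*) [Group G]

instance [TopologicalSpace G] : TopologicalSpace (FlatBase S G) :=
  inferInstanceAs (TopologicalSpace {x : Holonomy S G // x.FaceRel x})

instance [TopologicalSpace G] : TopologicalSpace (FlatCover S G) :=
  inferInstanceAs (TopologicalSpace
    {p : Holonomy S G × Holonomy S G // p.1.FaceRel p.2 ∧ p.2.FaceRel p.1})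

/-- `G` acts on `(V, c)` by simultaneous conjugation. -/
instance : MulAction G (FlatBase S G) where
  smul g x := ⟨x.1.gauge g g, x.2.gauge g g⟩
  one_smul x := Subtype.ext x.1.gauge_one
  mul_smul g h x := Subtype.ext (x.1.gauge_mul g h g h)

/-- `G × G` acts by
`(g, h) • (V, c, V', c') = (g V g⁻¹, g c h⁻¹, h V' h⁻¹, h c' g⁻¹)`. -/
instance : MulAction (G × G) (FlatCover S G) where
  smul k p := ⟨(p.1.1.gauge k.1 k.2, p.1.2.gauge k.2 k.1),
    p.2.1.gauge k.1 k.2, p.2.2.gauge k.2 k.1⟩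
  one_smul p := Subtype.ext (Prod.ext p.1.1.gauge_one p.1.2.gauge_one)
  mul_smul k k' p := Subtype.ext
    (Prod.ext (p.1.1.gauge_mul k.1 k'.1 k.2 k'.2) (p.1.2.gauge_mul k.2 k'.2 k.1 k'.1))

/-- The moduli space of flat `G`-connections on `S`. -/
abbrev ModuliBase : Type _ := MulAction.orbitRel.Quotient G (FlatBase S G)

/-- The moduli space of flat `G`-connections on the orientable double cover of `S`. -/
abbrev ModuliCover : Type _ := MulAction.orbitRel.Quotient (G × G) (FlatCover S G)

variable {S G}

/-- The class of a flat connection on `S`. -/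
def FlatBase.cls (x : FlatBase S G) : ModuliBase S G := Quotient.mk _ x

/-- The class of a flat connection on the orientable double cover of `S`. -/
def FlatCover.cls (p : FlatCover S G) : ModuliCover S G := Quotient.mk _ p

/-- The involution `(V, c, V', c') ↦ (V', c', V, c)` induced by the deck transformation. -/
def FlatCover.tau (p : FlatCover S G) : FlatCover S G := ⟨p.1.swap, p.2.symm⟩

/-- Pull-back of a flat connection to the double cover: `(V, c) ↦ (V, c, V, c)`. -/
def FlatBase.pullback (x : FlatBase S G) : FlatCover S G := ⟨(x.1, x.1), x.2, x.2⟩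

theorem FlatCover.tau_smul (k : G × G) (p : FlatCover S G) :
    (k • p).tau = k.swap • p.tau := rfl

theorem FlatBase.pullback_smul (g : G) (x : FlatBase S G) :
    (g • x).pullback = (g, g) • x.pullback := rfl

/-- The involution on the moduli space of the double cover. -/
def ModuliCover.tau : ModuliCover S G → ModuliCover S G :=
  Quotient.lift (fun p => p.tau.cls) (by
    rintro p q ⟨k, rfl⟩
    exact Quotient.sound ⟨k.swap, rfl⟩)

variable (S G) in
/-- The fixed point set of the involution on the moduli space of the double cover. -/
def fixedLocus : Set (ModuliCover S G) := {q | q.tau = q}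

/-- The natural map from the moduli space of `S` to the fixed point set of the involution on the
moduli space of the double cover, `[(V, c)] ↦ [(V, c, V, c)]`. -/
def naturalMap : ModuliBase S G → fixedLocus S G :=
  Quotient.lift (fun x => ⟨x.pullback.cls, rfl⟩) (by
    rintro x y ⟨g, rfl⟩
    exact Subtype.ext (Quotient.sound ⟨(g, g), rfl⟩))

/-- A flat connection on the double cover is generic if its stabilizer is the center of `G`,
embedded diagonally in `G × G`. -/
def FlatCover.IsGeneric (p : FlatCover S G) : Prop :=
  MulAction.stabilizer (G × G) p =
    (Subgroup.center G).map ((MonoidHom.id G).prod (MonoidHom.id G))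

variable (S G) in
/-- The smooth part of the fixed point set: the fixed classes of generic points. -/
def genericFixed : Set (fixedLocus S G) :=
  {q | ∃ p : FlatCover S G, p.IsGeneric ∧ p.cls = q.1}

variable (S G) in
/-- The smooth part of the moduli space of `S`: the classes of those `(V, c)` for which the point
`(V, c, V, c)` is generic. -/
def genericBase : Set (ModuliBase S G) :=
  {q | ∃ x : FlatBase S G, x.pullback.IsGeneric ∧ x.cls = q}

end Moduli

/-- The subgroup `2Z(G)` of squares of elements of the center `Z(G)`. -/
def twoCenter (G : Type*) [Group G] : Subgroup (Subgroup.center G) where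
  carrier := {z | ∃ w : Subgroup.center G, w ^ 2 = z}
  one_mem' := ⟨1, one_pow 2⟩
  mul_mem' := by
    rintro _ _ ⟨u, rfl⟩ ⟨v, rfl⟩
    exact ⟨u * v, (show Commute u v from
      Subtype.ext (Subgroup.mem_center_iff.1 v.2 u.1)).mul_pow 2⟩
  inv_mem' := by
    rintro _ ⟨u, rfl⟩
    exact ⟨u⁻¹, inv_pow u 2⟩

section Smooth

variable {E H N : Type*} [NormedAddCommGroup E] [NormedSpace ℝ E] [TopologicalSpace H]
  [TopologicalSpace N] [ChartedSpace H N]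

/-- Smooth real functions on a subset `X` of a manifold `N` : those which, near every point of `X`,
are restrictions of smooth functions on an open subset of `N`. -/
def IsSmoothOnSubset (J : ModelWithCorners ℝ E H) (X : Set N) (f : X → ℝ) : Prop :=
  ∀ x : X, ∃ (U : Set N) (F : N → ℝ), IsOpen U ∧ x.1 ∈ U ∧ ContMDiffOn J 𝓘(ℝ, ℝ) ∞ F U ∧
    ∀ y : X, y.1 ∈ U → f y = F y.1

end Smooth

section SmoothModuli

variable (n : ℕ) {S : NonorientableSurface} {G : Type*} [Group G] [TopologicalSpace G]
  [ChartedSpace (EuclideanSpace ℝ (Fin n)) G]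

/-- The model with corners of the manifold of all tuples `(V, c)`, a finite power of `G`. -/
noncomputable abbrev holonomyModel (S : NonorientableSurface) :=
  (ModelWithCorners.pi fun _ : S.LoopIndex => 𝓡 n).prod (𝓡 n)

/-- A real function on the smooth part of the moduli space of `S` is smooth if its composition
with the quotient map is smooth on the set of generic flat tuples `(V, c)`. -/
def IsSmoothBase (f : genericBase S G → ℝ) : Prop :=
  IsSmoothOnSubset (holonomyModel n S)
    {x : Holonomy S G | ∃ h : x.FaceRel x, FlatBase.cls ⟨x, h⟩ ∈ genericBase S G}
    (fun x => f ⟨FlatBase.cls ⟨x.1, x.2.1⟩, x.2.2⟩)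

/-- A real function on the smooth part of the fixed point set is smooth if its composition with
the quotient map is smooth on the set of generic flat tuples `(V, c, V', c')` with fixed class. -/
def IsSmoothFixed (f : genericFixed S G → ℝ) : Prop :=
  IsSmoothOnSubset ((holonomyModel n S).prod (holonomyModel n S))
    {p : Holonomy S G × Holonomy S G | ∃ (h : p.1.FaceRel p.2 ∧ p.2.FaceRel p.1)
      (hfix : FlatCover.cls ⟨p, h⟩ ∈ fixedLocus S G),
      (⟨FlatCover.cls ⟨p, h⟩, hfix⟩ : fixedLocus S G) ∈ genericFixed S G}
    (fun p => f ⟨⟨FlatCover.cls ⟨p.1, p.2.1⟩, p.2.2.1⟩, p.2.2.2⟩)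

variable (S G) in
/-- The natural map restricts to an isomorphism of the smooth parts: to a homeomorphism that
identifies the smooth functions on both sides. -/
def NaturalMapIsIsoOnSmoothParts : Prop :=
  ∃ φ : genericBase S G ≃ₜ genericFixed S G,
    (∀ q : genericBase S G, (φ q : fixedLocus S G) = naturalMap q.1) ∧
    ∀ f : genericFixed S G → ℝ, IsSmoothFixed n f ↔ IsSmoothBase n (f ∘ φ)

end SmoothModuli

/-! Fibres. If `(g, h)` carries the pullback of `x` to that of `y`, then so does `(h, g)`, and hence
`(h⁻¹g, g⁻¹h)` stabilizes the pullback of `x`. Genericity makes `z = h⁻¹g` central with `z² = 1`,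
and `y` is conjugate to `x` with `c` replaced by `zc`. Conversely, every central `z` with `z² = 1`
gives such a twist, and different `z` give different classes. The fibre is therefore the 2-torsion
of the finite abelian group `Z(G)`, which has as many elements as the cokernel of squaring
(`ncard_fiber_naturalMap`). The center is finite because it is compact, acts trivially by `Ad`, and
`Ad` has no nontrivial kernel near `1` when the Lie algebra has trivial center (`finite_center`).

Odd order is necessary. Twists by nontrivial 2-torsion destroy injectivity as soon as a generic
point exists, so the issue is existence for `ℓ ≥ 1` (`genericBase_nonempty`). A semisimple Lie
algebra is generated by two elements; exponentiating this approximately gives `a`, `b` arbitrarily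
close to `1` whose common centralizer is `Z(G)`. Their commutator is close to `1`, hence a square,
and the square root solves the surface relation. Only injectivity of the isomorphism is used here.

Odd order is sufficient. If `(k₁, k₂)` carries a generic `p` to `τp`, then `k₂k₁ = k₁k₂` is central.
Dividing both by a central square root of this product gives a pair `(g, g⁻¹)` carrying `p` to `τp`,
and then `(g, 1)` moves `p` to a pullback; so the map is bijective on smooth parts. It is a
homeomorphism because it is a closed map, from a compact space to a Hausdorff one. Smooth functions
correspond because `g` is unique and is locally the restriction of a smooth function of `p`: this is
an implicit function argument (`exists_contMDiffAt_eq_of_arrowGauge_eq`), made global in `g` by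
compactness (`exists_smooth_inv_pair`). -/

set_option linter.unusedSectionVars false

/-! ### Two generators of a semisimple Lie algebra -/

section LieGeneration

open LieAlgebra LieModule TensorProduct

/-- The Gram determinant is mapped to the Gram determinant by an injective ring homomorphism. -/
theorem LinearMap.BilinForm.Nondegenerate.baseChange_field {K A V : Type*} [Field K] [Field A]
    [Algebra K A] [AddCommGroup V] [Module K V] [FiniteDimensional K V]
    {B : LinearMap.BilinForm K V} (hB : B.Nondegenerate) :
    (LinearMap.BilinForm.baseChange A B).Nondegenerate := by
  classical
  let b := Module.finBasis K V
  rw [LinearMap.BilinForm.nondegenerate_iff_det_ne_zero (b.baseChange A)]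
  rw [LinearMap.BilinForm.nondegenerate_iff_det_ne_zero b] at hB
  have : BilinForm.toMatrix (b.baseChange A) (LinearMap.BilinForm.baseChange A B) =
      (algebraMap K A).mapMatrix (BilinForm.toMatrix b B) := by
    ext i j
    simp [BilinForm.toMatrix_apply, Algebra.algebraMap_eq_smul_one]
  rw [this, ← RingHom.map_det]
  simpa using hB

theorem LieAlgebra.IsKilling.baseChange_field (K A L : Type*) [Field K] [Field A] [Algebra K A]
    [LieRing L] [LieAlgebra K L] [FiniteDimensional K L] [IsKilling K L] :
    IsKilling A (A ⊗[K] L) where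
  killingCompl_top_eq_bot := by
    have h := (IsKilling.killingForm_nondegenerate K L).baseChange_field (A := A)
    rw [← LieModule.traceForm_baseChange] at h
    rw [LieSubmodule.eq_bot_iff]
    intro x hx
    exact h.2 x fun y => (LieIdeal.mem_killingCompl A (A ⊗[K] L) ⊤).1 hx y (LieSubmodule.mem_top y)

/-- If a sum of eigenvectors for distinct eigenvalues lies in an invariant subspace, then so does
every summand. -/
theorem Submodule.mem_of_sum_eigenvector_mem {K V ι : Type*} [Field K] [AddCommGroup V]
    [Module K V] (p : Submodule K V) (f : V →ₗ[K] V) (hf : ∀ v ∈ p, f v ∈ p) (μ : ι → K)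
    (s : Finset ι) (hμ : Set.InjOn μ s) (v : ι → V) (hv : ∀ i ∈ s, f (v i) = μ i • v i)
    (hs : ∑ i ∈ s, v i ∈ p) : ∀ i ∈ s, v i ∈ p := by
  classical
  induction s using Finset.induction_on generalizing v with
  | empty => simp
  | insert a s ha ih =>
    have key : ∀ i ∈ s, v i ∈ p := by
      have h1 : f (∑ i ∈ insert a s, v i) - μ a • ∑ i ∈ insert a s, v i ∈ p :=
        p.sub_mem (hf _ hs) (p.smul_mem _ hs)
      have h2 : f (∑ i ∈ insert a s, v i) - μ a • ∑ i ∈ insert a s, v i =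
          ∑ i ∈ s, (μ i - μ a) • v i := by
        rw [map_sum, Finset.smul_sum, ← Finset.sum_sub_distrib, Finset.sum_insert ha,
          hv a (by simp), sub_self, zero_add]
        exact Finset.sum_congr rfl fun i hi => by rw [hv i (by simp [hi]), sub_smul]
      rw [h2] at h1
      intro i hi
      have h3 := ih (hμ.mono (by simp)) (fun i => (μ i - μ a) • v i)
        (fun i hi => by rw [map_smul, hv i (by simp [hi]), smul_comm]) h1 i hi
      refine (p.smul_mem_iff ?_).1 h3
      rw [sub_ne_zero]
      intro h
      exact ha (hμ (by simp [hi]) (by simp) h ▸ hi)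
    intro i hi
    rcases Finset.mem_insert.1 hi with rfl | hi
    · rw [Finset.sum_insert ha] at hs
      exact (p.add_mem_iff_left (p.sum_mem key)).1 hs
    · exact key i hi

/-- The generators are an element `x` of a Cartan subalgebra on which all weights take different
values, and a sum of one root vector per root. Since `ad x` separates the summands, each root vector
is generated. Root spaces are lines, and brackets of opposite ones give the coroots, which span the
Cartan subalgebra. -/
theorem LieAlgebra.IsKilling.exists_lieSpan_pair_eq_top_of_isAlgClosed (K L : Type*) [Field K]
    [IsAlgClosed K] [CharZero K] [LieRing L] [LieAlgebra K L] [FiniteDimensional K L]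
    [IsKilling K L] : ∃ x y : L, LieSubalgebra.lieSpan K L {x, y} = ⊤ := by
  classical
  obtain ⟨z, hz⟩ := exists_isCartanSubalgebra_engel K L
  set H := LieSubalgebra.engel K z
  -- The differences of distinct weights are finitely many nonzero functionals, so they have a
  -- common point of nonvanishing.
  obtain ⟨x, -, hx⟩ := Module.Dual.exists_forall_mem_ne_zero_of_forall_exists
    (ι := {p : Weight K H L × Weight K H L // p.1 ≠ p.2}) (⊤ : Submodule K H)
    (fun p => p.1.1.toLinear - p.1.2.toLinear) (by
      rintro ⟨⟨α, β⟩, hab⟩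
      by_contra! hcon
      refine hab (Weight.ext fun h => ?_)
      have := hcon h trivial
      simpa [sub_eq_zero] using this)
  have hsp : ∀ α : Weight K H L, ∃ e ∈ rootSpace H α, e ≠ 0 := fun α => by
    obtain ⟨e, he, he0⟩ := α.exists_ne_zero
    exact ⟨e, he, he0⟩
  choose e he he0 using hsp
  let s : Finset (Weight K H L) := Finset.univ.filter fun α => α.IsNonZero
  refine ⟨x, ∑ α ∈ s, e α, ?_⟩
  set S := LieSubalgebra.lieSpan K L {(x : L), ∑ α ∈ s, e α} with hS
  have hxS : (x : L) ∈ S := LieSubalgebra.subset_lieSpan (by simp)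
  have heS : ∀ α : Weight K H L, α.IsNonZero → e α ∈ S := by
    intro α hα
    refine Submodule.mem_of_sum_eigenvector_mem S.toSubmodule (ad K L (x : L))
      (fun v hv => S.lie_mem hxS hv) (fun α => α x) s ?_ e ?_
      (LieSubalgebra.subset_lieSpan (by simp)) α (by simpa [s] using hα)
    · intro α _ β _ h
      by_contra hne
      exact hx ⟨(α, β), hne⟩ (by simpa [sub_eq_zero] using h)
    · intro α _
      exact IsKilling.lie_eq_smul_of_mem_rootSpace (he α) x
  have hroot : ∀ α : Weight K H L, α.IsNonZero → ∀ v ∈ rootSpace H α, v ∈ S := by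
    intro α hα v hv
    obtain ⟨c, hc⟩ := (finrank_eq_one_iff_of_nonzero' (⟨e α, he α⟩ : rootSpace H α)
      (by simpa [Subtype.ext_iff] using he0 α)).1 (IsKilling.finrank_rootSpace_eq_one α hα) ⟨v, hv⟩
    have : c • e α = v := congrArg Subtype.val hc
    exact this ▸ S.smul_mem c (heS α hα)
  have hcoroot : ∀ α : Weight K H L, α.IsNonZero → (IsKilling.coroot α : L) ∈ S := by
    intro α hα
    obtain ⟨h, u, v, ht, hu, hv⟩ := IsKilling.exists_isSl2Triple_of_weight_isNonZero hα
    rw [← ht.h_eq_coroot hα hu hv, ← ht.lie_e_f]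
    exact S.lie_mem (hroot α hα u hu) (hroot (-α) (by simpa using hα) v (by simpa using hv))
  have hH : H.toSubmodule ≤ S.toSubmodule := by
    intro h hh
    have h1 : (⟨h, hh⟩ : H) ∈ ⨆ α : Weight K H L, ⨆ (_ : α.IsNonZero), (corootSpace α).toSubmodule := by
      have := IsKilling.biSup_corootSpace_eq_top H
      have h2 := congrArg LieSubmodule.toSubmodule this
      simp only [LieSubmodule.iSup_toSubmodule] at h2
      rw [h2]
      trivial
    have h3 : (⨆ α : Weight K H L, ⨆ (_ : α.IsNonZero), (corootSpace α).toSubmodule) ≤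
        S.toSubmodule.comap H.toSubmodule.subtype := by
      refine iSup₂_le fun α hα => ?_
      rw [IsKilling.coe_corootSpace_eq_span_singleton, Submodule.span_singleton_le_iff_mem]
      exact hcoroot α hα
    exact h3 h1
  rw [eq_top_iff]
  have htop := congrArg LieSubmodule.toSubmodule (iSup_genWeightSpace_eq_top' K H L)
  simp only [LieSubmodule.iSup_toSubmodule] at htop
  intro v _
  have hle : (⨆ χ : Weight K H L, (genWeightSpace L χ).toSubmodule) ≤ S.toSubmodule := by
    refine iSup_le fun α => ?_
    by_cases hα : α.IsZero
    · intro v hv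
      apply hH
      have h0 : (α : H → K) = 0 := hα
      rw [h0] at hv
      simpa using hv
    · exact hroot α hα
  exact hle (htop ▸ Submodule.mem_top)

/-- The value of a nonassociative word when multiplication is read as the Lie bracket. -/
def LieAlgebra.evalWord {L : Type*} [LieRing L] (x : Bool → L) : FreeMagma Bool → L
  | .of i => x i
  | .mul u v => ⁅evalWord x u, evalWord x v⁆

theorem LieAlgebra.evalWord_mem_lieSpan {K L : Type*} [CommRing K] [LieRing L] [LieAlgebra K L]
    (x : Bool → L) (w : FreeMagma Bool) :
    evalWord x w ∈ LieSubalgebra.lieSpan K L (Set.range x) := by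
  induction w with
  | ih1 i => exact LieSubalgebra.subset_lieSpan ⟨i, rfl⟩
  | ih2 u v hu hv => exact LieSubalgebra.lie_mem _ hu hv

theorem LieAlgebra.lieSpan_le_span_evalWord {K L : Type*} [CommRing K] [LieRing L]
    [LieAlgebra K L] (x : Bool → L) :
    (LieSubalgebra.lieSpan K L (Set.range x)).toSubmodule ≤
      Submodule.span K (Set.range (evalWord x)) := by
  intro v hv
  refine LieSubalgebra.lieSpan_induction K
    (p := fun v _ => v ∈ Submodule.span K (Set.range (evalWord x))) ?_ (Submodule.zero_mem _)
    (fun _ _ _ _ h h' => Submodule.add_mem _ h h') (fun a _ _ h => Submodule.smul_mem _ a h)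
    ?_ hv
  · rintro _ ⟨i, rfl⟩
    exact Submodule.subset_span ⟨.of i, rfl⟩
  · intro y z _ _ hy hz
    clear * - hy hz
    induction hy using Submodule.span_induction with
    | mem y hy =>
      obtain ⟨u, rfl⟩ := hy
      induction hz using Submodule.span_induction with
      | mem z hz =>
        obtain ⟨w, rfl⟩ := hz
        exact Submodule.subset_span ⟨.mul u w, rfl⟩
      | zero => simp
      | add z z' _ _ h h' => rw [lie_add]; exact Submodule.add_mem _ h h'
      | smul a z _ h => rw [lie_smul]; exact Submodule.smul_mem _ a h
    | zero => simp
    | add y y' _ _ h h' => rw [add_lie]; exact Submodule.add_mem _ h h'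
    | smul a y _ h => rw [smul_lie]; exact Submodule.smul_mem _ a h

/-- The coordinates of a Lie word in two generic elements, for given structure constants. -/
noncomputable def LieAlgebra.wordCoord {K ι : Type*} [CommRing K] [Fintype ι] (c : ι → ι → ι → K) :
    FreeMagma Bool → ι → MvPolynomial (Bool × ι) K
  | .of i, k => MvPolynomial.X (i, k)
  | .mul u v, k => ∑ i, ∑ j, MvPolynomial.C (c i j k) * wordCoord c u i * wordCoord c v j

/-- With structure constants in `K`, one polynomial over `K` computes a word over every extension
`A`. This allows generation to descend from the algebraic closure. -/
theorem LieAlgebra.repr_evalWord {K A L ι : Type*} [CommRing K] [CommRing A] [Algebra K A]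
    [Fintype ι] [LieRing L] [LieAlgebra A L] (b : Module.Basis ι A L) (c : ι → ι → ι → K)
    (hc : ∀ i j k, b.repr ⁅b i, b j⁆ k = algebraMap K A (c i j k)) (x : Bool → L)
    (w : FreeMagma Bool) (k : ι) :
    b.repr (evalWord x w) k =
      MvPolynomial.aeval (fun p : Bool × ι => b.repr (x p.1) p.2) (wordCoord c w k) := by
  induction w generalizing k with
  | ih1 i => simp [evalWord, wordCoord]
  | ih2 u v hu hv =>
    change b.repr ⁅evalWord x u, evalWord x v⁆ k = MvPolynomial.aeval _
      (∑ i, ∑ j, MvPolynomial.C (c i j k) * wordCoord c u i * wordCoord c v j)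
    simp only [map_sum, map_mul, MvPolynomial.aeval_C, ← hu, ← hv, ← hc]
    conv_lhs => rw [← b.sum_repr (evalWord x u), ← b.sum_repr (evalWord x v)]
    simp only [sum_lie, lie_sum, smul_lie, lie_smul, map_sum, map_smul,
      Finsupp.coe_finsetSum, Finset.sum_apply, Finsupp.smul_apply, smul_eq_mul]
    rw [Finset.sum_comm]
    refine Finset.sum_congr rfl fun i _ => ?_
    rw [Finset.mul_sum]
    exact Finset.sum_congr rfl fun j _ => by ring

/-- A semisimple Lie algebra over a field of characteristic zero is generated by two elements. -/
theorem LieAlgebra.IsKilling.exists_lieSpan_pair_eq_top (K L : Type*) [Field K] [CharZero K]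
    [LieRing L] [LieAlgebra K L] [FiniteDimensional K L] [IsKilling K L] :
    ∃ x y : L, LieSubalgebra.lieSpan K L {x, y} = ⊤ := by
  classical
  let A := AlgebraicClosure K
  have : CharZero A := charZero_of_injective_algebraMap (algebraMap K A).injective
  have := IsKilling.baseChange_field K A L
  obtain ⟨x, y, hxy⟩ := IsKilling.exists_lieSpan_pair_eq_top_of_isAlgClosed A (A ⊗[K] L)
  let b := Module.finBasis K L
  let c := fun i j k => b.repr ⁅b i, b j⁆ k
  let b' := b.baseChange A
  have hc' : ∀ i j k, b'.repr ⁅b' i, b' j⁆ k = algebraMap K A (c i j k) := by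
    intro i j k
    simp [b', c, Algebra.algebraMap_eq_smul_one]
  let X : Bool → A ⊗[K] L := fun i => cond i x y
  have hX : Set.range X = {x, y} := by
    ext v; simp [X, eq_comm, or_comm]
  have hspan : Submodule.span A (Set.range (evalWord X)) = ⊤ := by
    rw [eq_top_iff]
    refine le_trans ?_ (lieSpan_le_span_evalWord X)
    rw [hX, hxy]
    exact le_rfl
  -- The words span over the closure, so some of them form a basis; the same words will be evaluated
  -- at a point over `K`.
  obtain ⟨κ, a, -, hsp, hli⟩ := exists_linearIndependent' A (evalWord X)
  let bκ : Module.Basis κ A (A ⊗[K] L) := Module.Basis.mk hli (by rw [hsp, hspan])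
  let w := a ∘ (b'.indexEquiv bκ)
  have hdet : b'.det (evalWord X ∘ w) ≠ 0 := by
    have : IsUnit (b'.det (bκ.reindex (b'.indexEquiv bκ).symm)) :=
      b'.isUnit_det (bκ.reindex (b'.indexEquiv bκ).symm)
    convert! this.ne_zero using 2
    ext i
    simp [bκ, w]
  let D : MvPolynomial (Bool × Fin (Module.finrank K L)) K :=
    Matrix.det (Matrix.of fun i j => wordCoord c (w j) i)
  have hD : D ≠ 0 := by
    intro h0
    apply hdet
    have h1 := congrArg (MvPolynomial.aeval (R := K) fun p : Bool × _ => b'.repr (X p.1) p.2) h0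
    rw [map_zero, AlgHom.map_det] at h1
    rw [Module.Basis.det_apply, ← h1]
    congr 1
    ext i j
    simp [Module.Basis.toMatrix_apply, repr_evalWord b' c hc' X]
  -- A nonzero polynomial over the infinite field `K` does not vanish at every `K`-point.
  obtain ⟨r, hr⟩ : ∃ r, MvPolynomial.eval r D ≠ 0 := by
    by_contra! hcon
    exact hD (MvPolynomial.funext fun r => by simpa using hcon r)
  let Y : Bool → L := fun i => ∑ k, r (i, k) • b k
  have hY : (fun p : Bool × _ => b.repr (Y p.1) p.2) = r := by
    funext ⟨i, k⟩
    simp [Y, Finsupp.single_apply]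
  have hdetY : b.det (evalWord Y ∘ w) ≠ 0 := by
    convert! hr
    rw [Module.Basis.det_apply, RingHom.map_det]
    congr 1
    ext i j
    simp [Module.Basis.toMatrix_apply, repr_evalWord b c (fun _ _ _ => rfl) Y, hY,
      MvPolynomial.aeval_eq_eval]
  refine ⟨Y true, Y false, ?_⟩
  have hYr : Set.range Y = {Y true, Y false} := by
    ext v; simp [or_comm]
  rw [← hYr, eq_top_iff]
  have htop := ((Module.Basis.is_basis_iff_det b).2 (isUnit_iff_ne_zero.2 hdetY)).2
  intro v _
  have hv : v ∈ Submodule.span K (Set.range (evalWord Y ∘ w)) := htop ▸ Submodule.mem_top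
  exact (Submodule.span_le (p := (LieSubalgebra.lieSpan K L (Set.range Y)).toSubmodule)).2
    (by rintro _ ⟨i, rfl⟩; exact evalWord_mem_lieSpan Y (w i)) hv

end LieGeneration

/-! ### The adjoint action in a chart, and the bracket as its derivative -/

section AdjointRepresentation

open Set Filter Topology

variable {E H G : Type*} [NormedAddCommGroup E] [NormedSpace ℝ E] [TopologicalSpace H]
  (I : ModelWithCorners ℝ E H) [I.Boundaryless] [Group G] [TopologicalSpace G]
  [ChartedSpace H G] [LieGroup I ∞ G]

/-- Conjugation by `g`, read in the chart at `1`. -/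
noncomputable def conjChart (g : G) (u : E) : E :=
  extChartAt I (1 : G) (g * (extChartAt I (1 : G)).symm u * g⁻¹)

/-- The adjoint action of a Lie group on its tangent space at `1`, in the chart at `1`. -/
noncomputable def adjointAction (g : G) : E →L[ℝ] E :=
  fderiv ℝ (conjChart I g) (extChartAt I (1 : G) 1)

/-- Multiplication, read in the chart at `1`. -/
noncomputable def mulChart (G : Type*) [Group G] [TopologicalSpace G] [ChartedSpace H G]
    (p : E × E) : E :=
  extChartAt I (1 : G) ((extChartAt I (1 : G)).symm p.1 * (extChartAt I (1 : G)).symm p.2)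

theorem contMDiffAt_extChartAt_symm_self {M : Type*} [TopologicalSpace M] [ChartedSpace H M]
    [IsManifold I ∞ M] (x : M) :
    ContMDiffAt 𝓘(ℝ, E) I ∞ (extChartAt I x).symm (extChartAt I x x) :=
  (contMDiffOn_extChartAt_symm x).contMDiffAt (extChartAt_target_mem_nhds x)

theorem contMDiffAt_conjChart (g : G) :
    ContMDiffAt (I.prod 𝓘(ℝ, E)) 𝓘(ℝ, E) ∞ (fun p : G × E => conjChart I p.1 p.2)
      (g, extChartAt I (1 : G) 1) := by
  have h1 : ContMDiffAt (I.prod 𝓘(ℝ, E)) I ∞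
      (fun p : G × E => p.1 * (extChartAt I (1 : G)).symm p.2 * p.1⁻¹)
      (g, extChartAt I (1 : G) 1) := by
    have h2 : ContMDiffAt (I.prod 𝓘(ℝ, E)) I ∞
        (fun p : G × E => (extChartAt I (1 : G)).symm p.2) (g, extChartAt I (1 : G) 1) :=
      ContMDiffAt.comp (g, extChartAt I (1 : G) 1)
        (contMDiffAt_extChartAt_symm_self I (1 : G)) contMDiffAt_snd
    exact (contMDiffAt_fst.mul h2).mul contMDiffAt_fst.inv
  refine ContMDiffAt.comp (g, extChartAt I (1 : G) 1) ?_ h1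
  simpa using contMDiffAt_extChartAt (I := I) (n := ∞) (x := (1 : G))

theorem contDiffAt_conjChart_extChartAt_symm (g : G) :
    ContDiffAt ℝ ∞ (fun p : E × E => conjChart I ((extChartAt I g).symm p.1) p.2)
      (extChartAt I g g, extChartAt I (1 : G) 1) := by
  rw [← contMDiffAt_iff_contDiffAt]
  have h := contMDiffAt_conjChart I g
  have h1 : ContMDiffAt 𝓘(ℝ, E × E) (I.prod 𝓘(ℝ, E)) ∞
      (fun p : E × E => ((extChartAt I g).symm p.1, p.2))
      (extChartAt I g g, extChartAt I (1 : G) 1) :=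
    (ContMDiffAt.comp (extChartAt I g g, extChartAt I (1 : G) 1)
      (contMDiffAt_extChartAt_symm_self I g) contDiff_fst.contMDiff.contMDiffAt).prodMk contDiff_snd.contMDiff.contMDiffAt
  refine ContMDiffAt.comp (g := fun p : G × E => conjChart I p.1 p.2)
    (extChartAt I g g, extChartAt I (1 : G) 1) ?_ h1
  convert! h
  exact extChartAt_to_inv g

theorem contDiffAt_mulChart :
    ContDiffAt ℝ ∞ (mulChart I G) (extChartAt I (1 : G) 1, extChartAt I (1 : G) 1) := by
  rw [← contMDiffAt_iff_contDiffAt]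
  set e := extChartAt I (1 : G) 1
  have h1 : ContMDiffAt 𝓘(ℝ, E × E) I ∞
      (fun p : E × E => (extChartAt I (1 : G)).symm p.1) (e, e) :=
    ContMDiffAt.comp (e, e) (contMDiffAt_extChartAt_symm_self I (1 : G)) contDiff_fst.contMDiff.contMDiffAt
  have h2 : ContMDiffAt 𝓘(ℝ, E × E) I ∞
      (fun p : E × E => (extChartAt I (1 : G)).symm p.2) (e, e) :=
    ContMDiffAt.comp (e, e) (contMDiffAt_extChartAt_symm_self I (1 : G)) contDiff_snd.contMDiff.contMDiffAt
  refine ContMDiffAt.comp (e, e) ?_ (h1.mul h2)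
  simpa [e] using contMDiffAt_extChartAt (I := I) (n := ∞) (x := (1 : G))

/-- A partial derivative of a jointly smooth map is smooth in the parameter. -/
theorem contDiffAt_adjointAction_extChartAt_symm (g : G) :
    ContDiffAt ℝ ∞ (fun v : E => adjointAction I ((extChartAt I g).symm v))
      (extChartAt I g g) :=
  ContDiffAt.fderiv (f := fun v u => conjChart I ((extChartAt I g).symm v) u)
    (g := fun _ => extChartAt I (1 : G) 1) (n := ∞)
    (contDiffAt_conjChart_extChartAt_symm I g) contDiffAt_const (by simp)

theorem continuous_adjointAction : Continuous (adjointAction I : G → E →L[ℝ] E) := by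
  rw [continuous_iff_continuousAt]
  intro g
  have h := (contDiffAt_adjointAction_extChartAt_symm I g).continuousAt.comp
    (continuousAt_extChartAt (I := I) g)
  refine h.congr ?_
  filter_upwards [extChartAt_source_mem_nhds (I := I) g] with x hx
  rw [Function.comp_apply, (extChartAt I g).left_inv hx]

theorem conjChart_base (g : G) :
    conjChart I g (extChartAt I (1 : G) 1) = extChartAt I (1 : G) 1 := by
  simp [conjChart]

theorem differentiableAt_conjChart (g : G) :
    DifferentiableAt ℝ (conjChart I g) (extChartAt I (1 : G) 1) := by
  have h := (contDiffAt_conjChart_extChartAt_symm I g).differentiableAt (by simp)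
  have h2 := DifferentiableAt.comp (extChartAt I (1 : G) 1)
    (g := fun p : E × E => conjChart I ((extChartAt I g).symm p.1) p.2)
    (f := fun u => (extChartAt I g g, u)) h (by fun_prop)
  simpa [Function.comp_def] using h2

theorem conjChart_mul_eventually (g h : G) :
    conjChart I (g * h) =ᶠ[𝓝 (extChartAt I (1 : G) 1)] conjChart I g ∘ conjChart I h := by
  have := topologicalGroup_of_lieGroup I ∞ (G := G)
  have hc : ContinuousAt (fun u : E => h * (extChartAt I (1 : G)).symm u * h⁻¹)
      (extChartAt I (1 : G) 1) :=
    (continuousAt_const.mul (contMDiffAt_extChartAt_symm_self I (1 : G)).continuousAt).mul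
      continuousAt_const
  have := hc.preimage_mem_nhds (t := (extChartAt I (1 : G)).source)
    (by simpa using extChartAt_source_mem_nhds (I := I) (1 : G))
  filter_upwards [this] with u hu
  simp only [conjChart, Function.comp_apply]
  rw [(extChartAt I (1 : G)).left_inv hu]
  group

theorem adjointAction_mul (g h : G) :
    adjointAction I (g * h) = adjointAction I g ∘L adjointAction I h := by
  rw [adjointAction, (conjChart_mul_eventually I g h).fderiv_eq, fderiv_comp,
    conjChart_base]
  · rfl
  · rw [conjChart_base]; exact differentiableAt_conjChart I g
  · exact differentiableAt_conjChart I h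

theorem adjointAction_one : adjointAction I (1 : G) = ContinuousLinearMap.id ℝ E := by
  have : conjChart I (1 : G) =ᶠ[𝓝 (extChartAt I (1 : G) 1)] id := by
    filter_upwards [extChartAt_target_mem_nhds (I := I) (1 : G)] with u hu
    rw [conjChart, one_mul, inv_one, mul_one, (extChartAt I (1 : G)).right_inv hu, id]
  rw [adjointAction, this.fderiv_eq, fderiv_id]

theorem adjointAction_of_mem_center {g : G} (hg : g ∈ Subgroup.center G) :
    adjointAction I g = ContinuousLinearMap.id ℝ E := by
  rw [← adjointAction_one (G := G) I, adjointAction, adjointAction]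
  congr 1
  funext u
  simp [conjChart, (Subgroup.mem_center_iff.1 hg _).symm]

/-- The derivative of chart multiplication in the second variable, at `1`. -/
noncomputable def leftTranslationDeriv (G : Type*) [Group G] [TopologicalSpace G]
    [ChartedSpace H G] (v : E) : E →L[ℝ] E :=
  fderiv ℝ (fun u => mulChart I G (v, u)) (extChartAt I (1 : G) 1)

/-- The derivative of chart multiplication in the first variable, at `1`. -/
noncomputable def rightTranslationDeriv (G : Type*) [Group G] [TopologicalSpace G]
    [ChartedSpace H G] (v : E) : E →L[ℝ] E :=
  fderiv ℝ (fun u => mulChart I G (u, v)) (extChartAt I (1 : G) 1)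

theorem mulChart_base_left_eventually :
    (fun u => mulChart I G (extChartAt I (1 : G) 1, u)) =ᶠ[𝓝 (extChartAt I (1 : G) 1)] id := by
  filter_upwards [extChartAt_target_mem_nhds (I := I) (1 : G)] with u hu
  rw [mulChart, extChartAt_to_inv, one_mul, (extChartAt I (1 : G)).right_inv hu, id]

theorem mulChart_base_right_eventually :
    (fun u => mulChart I G (u, extChartAt I (1 : G) 1)) =ᶠ[𝓝 (extChartAt I (1 : G) 1)] id := by
  filter_upwards [extChartAt_target_mem_nhds (I := I) (1 : G)] with u hu
  rw [mulChart, extChartAt_to_inv, mul_one, (extChartAt I (1 : G)).right_inv hu, id]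

theorem eventually_differentiableAt_mulChart :
    ∀ᶠ p in 𝓝 (extChartAt I (1 : G) 1, extChartAt I (1 : G) 1),
      DifferentiableAt ℝ (mulChart I G) p := by
  have h := ((contDiffAt_mulChart I (G := G)).of_le (m := 1)
    (by exact_mod_cast le_top)).eventually (by simp)
  filter_upwards [h] with p hp
  exact hp.differentiableAt (by simp)

theorem leftTranslationDeriv_eventually :
    leftTranslationDeriv I G =ᶠ[𝓝 (extChartAt I (1 : G) 1)] fun v =>
      (fderiv ℝ (mulChart I G) (v, extChartAt I (1 : G) 1)) ∘L ContinuousLinearMap.inr ℝ E E := by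
  have hc : ContinuousAt (fun v : E => (v, extChartAt I (1 : G) 1)) (extChartAt I (1 : G) 1) := by
    fun_prop
  filter_upwards [hc.eventually (eventually_differentiableAt_mulChart I (G := G))] with v hv
  exact (hv.hasFDerivAt.comp _ (hasFDerivAt_prodMk_right v (extChartAt I (1 : G) 1))).fderiv

theorem rightTranslationDeriv_eventually :
    rightTranslationDeriv I G =ᶠ[𝓝 (extChartAt I (1 : G) 1)] fun v =>
      (fderiv ℝ (mulChart I G) (extChartAt I (1 : G) 1, v)) ∘L ContinuousLinearMap.inl ℝ E E := by
  have hc : ContinuousAt (fun v : E => (extChartAt I (1 : G) 1, v)) (extChartAt I (1 : G) 1) := by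
    fun_prop
  filter_upwards [hc.eventually (eventually_differentiableAt_mulChart I (G := G))] with v hv
  exact (HasFDerivAt.comp _ (g := mulChart I G) (f := fun w => (w, v)) hv.hasFDerivAt
    (hasFDerivAt_prodMk_left (extChartAt I (1 : G) 1) v)).fderiv

theorem hasFDerivAt_fderiv_mulChart :
    HasFDerivAt (fderiv ℝ (mulChart I G))
      (fderiv ℝ (fderiv ℝ (mulChart I G)) (extChartAt I (1 : G) 1, extChartAt I (1 : G) 1))
      (extChartAt I (1 : G) 1, extChartAt I (1 : G) 1) :=
  (((contDiffAt_mulChart I (G := G)).fderiv_right (m := ∞) (by simp)).differentiableAt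
    (by simp)).hasFDerivAt

theorem hasFDerivAt_leftTranslationDeriv :
    HasFDerivAt (leftTranslationDeriv I G)
      (((ContinuousLinearMap.compL ℝ E (E × E) E).flip (ContinuousLinearMap.inr ℝ E E)) ∘L
        (fderiv ℝ (fderiv ℝ (mulChart I G)) (extChartAt I (1 : G) 1, extChartAt I (1 : G) 1)) ∘L
        ContinuousLinearMap.inl ℝ E E) (extChartAt I (1 : G) 1) := by
  refine HasFDerivAt.congr_of_eventuallyEq ?_ (leftTranslationDeriv_eventually I)
  exact (((ContinuousLinearMap.compL ℝ E (E × E) E).flip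
    (ContinuousLinearMap.inr ℝ E E)).hasFDerivAt).comp _
    (HasFDerivAt.comp _ (g := fderiv ℝ (mulChart I G))
      (f := fun v => (v, extChartAt I (1 : G) 1)) (hasFDerivAt_fderiv_mulChart I (G := G))
      (hasFDerivAt_prodMk_left (extChartAt I (1 : G) 1) (extChartAt I (1 : G) 1)))

theorem hasFDerivAt_rightTranslationDeriv :
    HasFDerivAt (rightTranslationDeriv I G)
      (((ContinuousLinearMap.compL ℝ E (E × E) E).flip (ContinuousLinearMap.inl ℝ E E)) ∘L
        (fderiv ℝ (fderiv ℝ (mulChart I G)) (extChartAt I (1 : G) 1, extChartAt I (1 : G) 1)) ∘L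
        ContinuousLinearMap.inr ℝ E E) (extChartAt I (1 : G) 1) := by
  refine HasFDerivAt.congr_of_eventuallyEq ?_ (rightTranslationDeriv_eventually I)
  exact (((ContinuousLinearMap.compL ℝ E (E × E) E).flip
    (ContinuousLinearMap.inl ℝ E E)).hasFDerivAt).comp _
    ((hasFDerivAt_fderiv_mulChart I (G := G)).comp _
      (hasFDerivAt_prodMk_right (extChartAt I (1 : G) 1) (extChartAt I (1 : G) 1)))

/-- Both sides are the mixed second derivative of chart multiplication, which is symmetric. -/
theorem fderiv_rightTranslationDeriv_apply (x y : E) :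
    fderiv ℝ (rightTranslationDeriv I G) (extChartAt I (1 : G) 1) y x =
      fderiv ℝ (leftTranslationDeriv I G) (extChartAt I (1 : G) 1) x y := by
  rw [(hasFDerivAt_rightTranslationDeriv I).fderiv, (hasFDerivAt_leftTranslationDeriv I).fderiv]
  have h := (contDiffAt_mulChart I (G := G)).isSymmSndFDerivAt (by simpa using ENat.LEInfty.out)
  exact h.eq _ _

/-- This is `g u = (g u g⁻¹) g`, differentiated in `u` at `1`. -/
theorem leftTranslationDeriv_eq_comp_eventually :
    leftTranslationDeriv I G =ᶠ[𝓝 (extChartAt I (1 : G) 1)] fun v =>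
      rightTranslationDeriv I G v ∘L adjointAction I ((extChartAt I (1 : G)).symm v) := by
  have := topologicalGroup_of_lieGroup I ∞ (G := G)
  set e := extChartAt I (1 : G) 1 with he
  have hc : ContinuousAt (fun v : E => (e, v)) e := by fun_prop
  filter_upwards [hc.eventually (eventually_differentiableAt_mulChart I (G := G)),
    extChartAt_target_mem_nhds (I := I) (1 : G)] with v hv hvt
  set g := (extChartAt I (1 : G)).symm v with hg
  have hcg : ContinuousAt (fun u : E => g * (extChartAt I (1 : G)).symm u * g⁻¹) e :=
    (continuousAt_const.mul (contMDiffAt_extChartAt_symm_self I (1 : G)).continuousAt).mul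
      continuousAt_const
  have hmem := hcg.preimage_mem_nhds (t := (extChartAt I (1 : G)).source)
    (by simpa [he] using extChartAt_source_mem_nhds (I := I) (1 : G))
  have heq : (fun u => mulChart I G (v, u)) =ᶠ[𝓝 e]
      (fun w => mulChart I G (w, v)) ∘ conjChart I g := by
    filter_upwards [hmem] with u hu
    simp only [mulChart, conjChart, Function.comp_apply, ← hg]
    rw [(extChartAt I (1 : G)).left_inv hu]
    group
  have hd : DifferentiableAt ℝ (fun w => mulChart I G (w, v)) (conjChart I g e) := by
    rw [he, conjChart_base]
    exact DifferentiableAt.comp e (g := mulChart I G) (f := fun w => (w, v)) hv (by fun_prop)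
  rw [leftTranslationDeriv, heq.fderiv_eq, fderiv_comp e hd (differentiableAt_conjChart I g), he,
    conjChart_base]
  rfl

/-- The product rule applied to `L = R ∘ Ad` at `1`, where all three are the identity; the
derivative of `R` is that of `L` with its arguments exchanged. -/
theorem fderiv_adjointAction_apply (x y : E) :
    fderiv ℝ (fun v : E => adjointAction I ((extChartAt I (1 : G)).symm v))
      (extChartAt I (1 : G) 1) y x =
    fderiv ℝ (leftTranslationDeriv I G) (extChartAt I (1 : G) 1) y x -
      fderiv ℝ (leftTranslationDeriv I G) (extChartAt I (1 : G) 1) x y := by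
  have hA := ((contDiffAt_adjointAction_extChartAt_symm I (1 : G)).differentiableAt
    (by simp)).hasFDerivAt
  have hR := (hasFDerivAt_rightTranslationDeriv I (G := G)).differentiableAt.hasFDerivAt
  have h1 : rightTranslationDeriv I G (extChartAt I (1 : G) 1) = ContinuousLinearMap.id ℝ E := by
    rw [rightTranslationDeriv, (mulChart_base_right_eventually I).fderiv_eq, fderiv_id]
  have h := (leftTranslationDeriv_eq_comp_eventually I (G := G)).fderiv_eq (𝕜 := ℝ)
  rw [(hR.clm_comp hA).fderiv] at h
  have h' := congrArg (fun T : E →L[ℝ] E →L[ℝ] E => T y x) h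
  simp only [extChartAt_to_inv, adjointAction_one, h1, add_apply,
    ContinuousLinearMap.comp_apply, ContinuousLinearMap.compL_apply, ContinuousLinearMap.flip_apply,
    ContinuousLinearMap.id_comp, ContinuousLinearMap.comp_id] at h'
  rw [h', fderiv_rightTranslationDeriv_apply]
  abel

/-- Identifies `leftTranslationDeriv` with left-invariant fields read in the chart, so that their
bracket can be computed in `E`. -/
theorem leftTranslationDeriv_eq_mfderiv {v : E} (hv : v ∈ (extChartAt I (1 : G)).target) (y : E) :
    leftTranslationDeriv I G v y =
      mfderiv I 𝓘(ℝ, E) (extChartAt I (1 : G)) ((extChartAt I (1 : G)).symm v)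
        (mulInvariantVectorField (I := I) (G := G) y ((extChartAt I (1 : G)).symm v)) := by
  set g := (extChartAt I (1 : G)).symm v with hg
  set e := extChartAt I (1 : G) 1 with he
  have hgs : g ∈ (chartAt H (1 : G)).source := by
    rw [← extChartAt_source I]; exact (extChartAt I (1 : G)).map_target hv
  have h1 : HasMFDerivAt 𝓘(ℝ, E) I (extChartAt I (1 : G)).symm e
      (ContinuousLinearMap.id ℝ E) := by
    have h := ((contMDiffAt_extChartAt_symm_self I (1 : G)).mdifferentiableAt
      (by simp)).hasMFDerivAt
    refine h.congr_mfderiv ?_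
    rw [← mfderivWithin_univ, ← I.range_eq_univ]
    exact mfderivWithin_range_extChartAt_symm (I := I) (x := (1 : G))
  have h2 : HasMFDerivAt I I (g * ·) ((extChartAt I (1 : G)).symm e)
      (mfderiv I I (g * ·) ((extChartAt I (1 : G)).symm e)) :=
    ((contMDiff_mul_left (I := I) (n := ∞)).contMDiffAt.mdifferentiableAt
      (by simp)).hasMFDerivAt
  have h3 : HasMFDerivAt I 𝓘(ℝ, E) (extChartAt I (1 : G)) (g * (extChartAt I (1 : G)).symm e)
      (mfderiv I 𝓘(ℝ, E) (extChartAt I (1 : G)) (g * (extChartAt I (1 : G)).symm e)) := by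
    refine (mdifferentiableAt_extChartAt ?_).hasMFDerivAt
    rw [he, extChartAt_to_inv, mul_one]
    exact hgs
  have he1 : (extChartAt I (1 : G)).symm e = 1 := extChartAt_to_inv 1
  let A : G → E →L[ℝ] E := fun k => mfderiv I 𝓘(ℝ, E) (extChartAt I (1 : G)) k
  let B : G → E →L[ℝ] E := fun k => mfderiv I I (g * ·) k
  have h4 : HasFDerivAt (fun u => mulChart I G (v, u))
      (A (g * (extChartAt I (1 : G)).symm e) ∘L B ((extChartAt I (1 : G)).symm e)) e :=
    (HasMFDerivAt.comp e (g := extChartAt I (1 : G))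
      (f := (g * ·) ∘ (extChartAt I (1 : G)).symm) h3
      (HasMFDerivAt.comp e (g := (g * ·)) h2 h1)).hasFDerivAt
  rw [leftTranslationDeriv, h4.fderiv, he1, mul_one]
  rfl

theorem mpullback_mulInvariantVectorField_eventually (y : E) :
    VectorField.mpullbackWithin 𝓘(ℝ, E) I (extChartAt I (1 : G)).symm
      (mulInvariantVectorField (I := I) (G := G) y) (range I) =ᶠ[𝓝 (extChartAt I (1 : G) 1)]
      fun v => leftTranslationDeriv I G v y := by
  filter_upwards [extChartAt_target_mem_nhds (I := I) (1 : G)] with v hv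
  rw [VectorField.mpullbackWithin_apply]
  refine ((isInvertible_mfderivWithin_extChartAt_symm hv).inverse_apply_eq).2 ?_
  rw [leftTranslationDeriv_eq_mfderiv I hv]
  exact (DFunLike.congr_fun (mfderivWithin_extChartAt_symm_comp_mfderiv_extChartAt hv)
    (mulInvariantVectorField (I := I) (G := G) y ((extChartAt I (1 : G)).symm v))).symm

theorem lieBracketWithin_mulInvariantVectorField (y x : E) :
    VectorField.lieBracketWithin ℝ
      (VectorField.mpullbackWithin 𝓘(ℝ, E) I (extChartAt I (1 : G)).symm
        (mulInvariantVectorField (I := I) (G := G) y) (range I))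
      (VectorField.mpullbackWithin 𝓘(ℝ, E) I (extChartAt I (1 : G)).symm
        (mulInvariantVectorField (I := I) (G := G) x) (range I))
      ((extChartAt I (1 : G)).symm ⁻¹' univ ∩ range I) (extChartAt I (1 : G) 1) =
      fderiv ℝ (leftTranslationDeriv I G) (extChartAt I (1 : G) 1) y x -
      fderiv ℝ (leftTranslationDeriv I G) (extChartAt I (1 : G) 1) x y := by
  have hL := (hasFDerivAt_leftTranslationDeriv I (G := G)).differentiableAt.hasFDerivAt
  have h1 : leftTranslationDeriv I G (extChartAt I (1 : G) 1) = ContinuousLinearMap.id ℝ E := by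
    rw [leftTranslationDeriv, (mulChart_base_left_eventually I).fderiv_eq, fderiv_id]
  have hd : ∀ y x : E, fderiv ℝ (fun v => leftTranslationDeriv I G v y)
      (extChartAt I (1 : G) 1) x =
      fderiv ℝ (leftTranslationDeriv I G) (extChartAt I (1 : G) 1) x y := by
    intro y x
    have := (hL.clm_apply (hasFDerivAt_const y _)).fderiv
    rw [this]
    simp
  let V : E → E → E := fun y => VectorField.mpullbackWithin 𝓘(ℝ, E) I (extChartAt I (1 : G)).symm
    (mulInvariantVectorField (I := I) (G := G) y) (range I)
  have hV : ∀ y, V y =ᶠ[𝓝 (extChartAt I (1 : G) 1)] fun v => leftTranslationDeriv I G v y :=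
    fun y => mpullback_mulInvariantVectorField_eventually I (G := G) y
  have hs : (extChartAt I (1 : G)).symm ⁻¹' univ ∩ range I = univ := by
    simp [I.range_eq_univ]
  change VectorField.lieBracketWithin ℝ (V y) (V x) _ _ = _
  rw [hs, VectorField.lieBracketWithin_univ]
  refine ((hV y).lieBracket_vectorField_eq (hV x)).trans ?_
  simp only [VectorField.lieBracket]
  rw [hd, hd, h1]
  rfl

theorem bracket_eq_fderiv_adjointAction (y x : GroupLieAlgebra I G) :
    ⁅y, x⁆ = fderiv ℝ (fun v : E => adjointAction I ((extChartAt I (1 : G)).symm v))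
      (extChartAt I (1 : G) 1) y x := by
  refine Eq.trans ?_ (fderiv_adjointAction_apply I x y).symm
  have hinv : (mfderiv I 𝓘(ℝ, E) (extChartAt I (1 : G)) 1).inverse =
      ContinuousLinearMap.id ℝ E := by
    rw [mfderiv_extChartAt_self]
    exact ContinuousLinearMap.inverse_id
  exact (DFunLike.congr_fun hinv _).trans
    (lieBracketWithin_mulInvariantVectorField I y x)

end AdjointRepresentation

/-! ### Maps with vanishing derivative -/

section LocallyConstant

open Set Filter Topology

section

variable {E H M E' H' N E'' H'' P : Type*}
    [NormedAddCommGroup E] [NormedSpace ℝ E] [TopologicalSpace H] {I : ModelWithCorners ℝ E H}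
    [TopologicalSpace M] [ChartedSpace H M]
    [NormedAddCommGroup E'] [NormedSpace ℝ E'] [TopologicalSpace H'] {J : ModelWithCorners ℝ E' H'}
    [TopologicalSpace N] [ChartedSpace H' N]
    [NormedAddCommGroup E''] [NormedSpace ℝ E''] [TopologicalSpace H'']
    {K : ModelWithCorners ℝ E'' H''} [TopologicalSpace P] [ChartedSpace H'' P]
    {f : M → N} {g : N → P} {x : M}

theorem MDifferentiableAt.comp_hasMFDerivAt_zero (hg : MDifferentiableAt J K g (f x))
    (hf : HasMFDerivAt I J f x 0) : HasMFDerivAt I K (g ∘ f) x 0 := by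
  refine (hg.hasMFDerivAt.comp x hf).congr_mfderiv ?_
  rw [ContinuousLinearMap.comp_zero]

theorem HasMFDerivAt.zero_comp_mdifferentiableAt (hg : HasMFDerivAt J K g (f x) 0)
    (hf : MDifferentiableAt I J f x) : HasMFDerivAt I K (g ∘ f) x 0 := by
  refine (hg.comp x hf.hasMFDerivAt).congr_mfderiv ?_
  rw [ContinuousLinearMap.zero_comp]

end

/-- In charts the map has zero derivative on a ball, which is convex. -/
theorem eventually_eq_of_eventually_hasMFDerivAt_zero {E H M E' H' N : Type*}
    [NormedAddCommGroup E] [NormedSpace ℝ E] [TopologicalSpace H] (I : ModelWithCorners ℝ E H)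
    [I.Boundaryless] [TopologicalSpace M] [ChartedSpace H M] [IsManifold I ∞ M]
    [NormedAddCommGroup E'] [NormedSpace ℝ E'] [TopologicalSpace H'] (J : ModelWithCorners ℝ E' H')
    [TopologicalSpace N] [ChartedSpace H' N] [IsManifold J ∞ N]
    {f : M → N} {x : M} (hf : ∀ᶠ y in 𝓝 x, HasMFDerivAt I J f y 0) :
    ∀ᶠ y in 𝓝 x, f y = f x := by
  have hsrc : ∀ᶠ y in 𝓝 x, f y ∈ (extChartAt J (f x)).source :=
    hf.self_of_nhds.continuousAt.eventually (extChartAt_source_mem_nhds (f x))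
  have hinv : ContinuousAt (extChartAt I x).symm (extChartAt I x x) := continuousAt_extChartAt_symm x
  have hev : ∀ᶠ v in 𝓝 (extChartAt I x x), v ∈ (extChartAt I x).target ∧
      HasMFDerivAt I J f ((extChartAt I x).symm v) 0 ∧
      f ((extChartAt I x).symm v) ∈ (extChartAt J (f x)).source := by
    refine Filter.Eventually.and (extChartAt_target_mem_nhds (I := I) x) 
      (hinv.eventually (p := fun y => HasMFDerivAt I J f y 0 ∧ f y ∈ (extChartAt J (f x)).source) ?_)
    rw [extChartAt_to_inv]
    exact hf.and hsrc
  obtain ⟨r, hr, hball⟩ := Metric.eventually_nhds_iff_ball.1 hev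
  let k : E → E' := extChartAt J (f x) ∘ f ∘ (extChartAt I x).symm
  have hk : ∀ v ∈ Metric.ball (extChartAt I x x) r, HasFDerivAt k (0 : E →L[ℝ] E') v := by
    intro v hv
    obtain ⟨h1, h2, h3⟩ := hball v hv
    have h4 : MDifferentiableAt J 𝓘(ℝ, E') (extChartAt J (f x)) (f ((extChartAt I x).symm v)) :=
      mdifferentiableAt_extChartAt (by rwa [← extChartAt_source J])
    have h5 : MDifferentiableAt 𝓘(ℝ, E) I (extChartAt I x).symm v :=
      ((contMDiffOn_extChartAt_symm (n := ∞) x).contMDiffAt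
        ((isOpen_extChartAt_target x).mem_nhds h1)).mdifferentiableAt (by simp)
    have h6 : HasMFDerivAt 𝓘(ℝ, E) J (f ∘ (extChartAt I x).symm) v 0 :=
      h2.zero_comp_mdifferentiableAt h5
    have h7 : HasMFDerivAt 𝓘(ℝ, E) 𝓘(ℝ, E') k v 0 :=
      MDifferentiableAt.comp_hasMFDerivAt_zero (f := f ∘ (extChartAt I x).symm) h4 h6
    exact h7.hasFDerivAt
  have hconst : ∀ v ∈ Metric.ball (extChartAt I x x) r, k v = k (extChartAt I x x) := by
    intro v hv
    exact (convex_ball _ _).is_const_of_fderivWithin_eq_zero (𝕜 := ℝ)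
      (fun w hw => (hk w hw).differentiableAt.differentiableWithinAt)
      (fun w hw => by
        rw [fderivWithin_of_isOpen Metric.isOpen_ball hw, (hk w hw).fderiv])
      hv (Metric.mem_ball_self hr)
  filter_upwards [(continuousAt_extChartAt (I := I) x).eventually (Metric.ball_mem_nhds _ hr),
    extChartAt_source_mem_nhds (I := I) x, hsrc] with y hy hys hfy
  have h := hconst _ hy
  simp only [k, Function.comp_apply, extChartAt_to_inv, (extChartAt I x).left_inv hys] at h
  exact (extChartAt J (f x)).injOn hfy (mem_extChartAt_source (f x)) h

end LocallyConstant

/-! ### The kernel of the adjoint action of a connected group -/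

section AdjointRepresentation

open Set Filter Topology

variable {E H G : Type*} [NormedAddCommGroup E] [NormedSpace ℝ E] [TopologicalSpace H]
  (I : ModelWithCorners ℝ E H) [I.Boundaryless] [Group G] [TopologicalSpace G]
  [ChartedSpace H G] [LieGroup I ∞ G]

theorem hasFDerivAt_mulChart :
    HasFDerivAt (mulChart I G) (ContinuousLinearMap.fst ℝ E E + ContinuousLinearMap.snd ℝ E E)
      (extChartAt I (1 : G) 1, extChartAt I (1 : G) 1) := by
  have h := ((contDiffAt_mulChart I (G := G)).differentiableAt (by simp)).hasFDerivAt
  convert! h using 1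
  have h1 := (leftTranslationDeriv_eventually I (G := G)).self_of_nhds
  have h2 := (rightTranslationDeriv_eventually I (G := G)).self_of_nhds
  rw [leftTranslationDeriv, (mulChart_base_left_eventually I).fderiv_eq, fderiv_id] at h1
  rw [rightTranslationDeriv, (mulChart_base_right_eventually I).fderiv_eq, fderiv_id] at h2
  ext v
  · exact DFunLike.congr_fun h2 v ▸ by simp
  · exact DFunLike.congr_fun h1 v ▸ by simp

theorem contMDiff_conj_mul_inv (g : G) : ContMDiff I I ∞ fun x : G => g * x * g⁻¹ * x⁻¹ :=
  ((contMDiff_const.mul contMDiff_id).mul contMDiff_const).mul contMDiff_id.inv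

/-- Conjugation is the product of this map with the identity, and derivatives of factors add at `1`;
thus `Ad g` is the derivative in question plus the identity. -/
theorem hasMFDerivAt_conj_mul_inv_one {g : G}
    (hg : adjointAction I g = ContinuousLinearMap.id ℝ E) :
    HasMFDerivAt I I (fun x : G => g * x * g⁻¹ * x⁻¹) 1 0 := by
  have := topologicalGroup_of_lieGroup I ∞ (G := G)
  set e := extChartAt I (1 : G) 1 with he
  let F : G → G := fun x => g * x * g⁻¹ * x⁻¹
  have hF : ContMDiff I I ∞ F := contMDiff_conj_mul_inv I g
  have hF1 : F 1 = 1 := by simp [F]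
  let D : E → E := extChartAt I (1 : G) ∘ F ∘ (extChartAt I (1 : G)).symm
  have hDe : D e = e := by simp only [D, Function.comp_apply, he, extChartAt_to_inv, hF1]
  have hDd : DifferentiableAt ℝ D e := by
    rw [← mdifferentiableAt_iff_differentiableAt]
    refine ContMDiffAt.mdifferentiableAt (n := ∞) ?_ (by simp)
    refine ContMDiffAt.comp e (I' := I) ?_ (hF.contMDiffAt.comp e
      (contMDiffAt_extChartAt_symm_self I (1 : G)))
    rw [Function.comp_apply, he, extChartAt_to_inv, hF1]
    exact contMDiffAt_extChartAt
  have hFc : ContinuousAt (F ∘ (extChartAt I (1 : G)).symm) e :=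
    hF.continuous.continuousAt.comp (contMDiffAt_extChartAt_symm_self I (1 : G)).continuousAt
  have heq : conjChart I g =ᶠ[𝓝 e] fun u => mulChart I G (D u, u) := by
    have hm := hFc.preimage_mem_nhds (t := (extChartAt I (1 : G)).source) (by
      rw [Function.comp_apply, he, extChartAt_to_inv, hF1]
      exact extChartAt_source_mem_nhds (I := I) (1 : G))
    filter_upwards [hm] with u hu
    simp only [conjChart, mulChart, D, Function.comp_apply]
    rw [(extChartAt I (1 : G)).left_inv (show F _ ∈ _ from hu)]
    simp [F]
  have hm : HasFDerivAt (mulChart I G)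
      (ContinuousLinearMap.fst ℝ E E + ContinuousLinearMap.snd ℝ E E) (D e, e) := by
    rw [hDe]; exact hasFDerivAt_mulChart I
  have hchain := HasFDerivAt.comp e (g := mulChart I G) (f := fun u => (D u, u)) hm
    (hDd.hasFDerivAt.prodMk (hasFDerivAt_id e))
  have hD0 : fderiv ℝ D e = 0 := by
    have h1 := heq.fderiv_eq (𝕜 := ℝ)
    rw [show fderiv ℝ (fun u => mulChart I G (D u, u)) e = _ from hchain.fderiv] at h1
    have h2 : fderiv ℝ (conjChart I g) e = ContinuousLinearMap.id ℝ E := hg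
    rw [h2] at h1
    ext v
    have h3 := DFunLike.congr_fun h1 v
    simpa using h3
  have hD : HasFDerivAt D (0 : E →L[ℝ] E) e := hD0 ▸ hDd.hasFDerivAt
  have h1 : MDifferentiableAt I 𝓘(ℝ, E) (extChartAt I (1 : G)) 1 :=
    mdifferentiableAt_extChartAt (mem_chart_source H (1 : G))
  have h2 : MDifferentiableAt 𝓘(ℝ, E) I (extChartAt I (1 : G)).symm (D e) := by
    rw [hDe]
    exact (contMDiffAt_extChartAt_symm_self I (1 : G)).mdifferentiableAt (by simp)
  have h3 : HasMFDerivAt 𝓘(ℝ, E) I ((extChartAt I (1 : G)).symm ∘ D) e 0 :=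
    h2.comp_hasMFDerivAt_zero (x := e) hD.hasMFDerivAt
  have h4 : HasMFDerivAt I I (((extChartAt I (1 : G)).symm ∘ D) ∘ extChartAt I (1 : G)) 1 0 :=
    HasMFDerivAt.zero_comp_mdifferentiableAt (f := extChartAt I (1 : G)) h3 h1
  refine h4.congr_of_eventuallyEq ?_
  have hFc1 : ContinuousAt F 1 := hF.continuous.continuousAt
  filter_upwards [extChartAt_source_mem_nhds (I := I) (1 : G),
    hFc1.eventually (by rw [hF1]; exact extChartAt_source_mem_nhds (I := I) (1 : G))] with x hx hFx
  simp only [D, Function.comp_apply]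
  rw [(extChartAt I (1 : G)).left_inv hx, (extChartAt I (1 : G)).left_inv hFx]

/-- The map `F x = g x g⁻¹ x⁻¹` satisfies `F (h x) = (g h g⁻¹) F x h⁻¹`, so its derivative vanishes
everywhere once it vanishes at `1`. By connectedness `F` is constantly `F 1 = 1`. -/
theorem mem_center_of_adjointAction_eq_id [ConnectedSpace G] {g : G}
    (hg : adjointAction I g = ContinuousLinearMap.id ℝ E) : g ∈ Subgroup.center G := by
  let F : G → G := fun x => g * x * g⁻¹ * x⁻¹
  have hF : ∀ h : G, HasMFDerivAt I I F h 0 := by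
    intro h
    have h1 : HasMFDerivAt I I F (h⁻¹ * h) 0 := by
      rw [inv_mul_cancel]; exact hasMFDerivAt_conj_mul_inv_one I hg
    have hl : MDifferentiableAt I I (fun x : G => h⁻¹ * x) h :=
      (contMDiff_mul_left (I := I) (n := ∞)).contMDiffAt.mdifferentiableAt (by simp)
    have ho : MDifferentiableAt I I (fun x : G => g * h * g⁻¹ * x * h⁻¹) (F (h⁻¹ * h)) :=
      ((contMDiff_const.mul contMDiff_id).mul contMDiff_const :
        ContMDiff I I ∞ fun x : G => g * h * g⁻¹ * x * h⁻¹).contMDiffAt.mdifferentiableAt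
        (by simp)
    have hc := (ho.comp_hasMFDerivAt_zero h1).zero_comp_mdifferentiableAt hl
    have heq : ((fun x : G => g * h * g⁻¹ * x * h⁻¹) ∘ F) ∘ (fun x : G => h⁻¹ * x) = F := by
      funext x
      simp [F, mul_assoc]
    rwa [heq] at hc
  have hloc : IsLocallyConstant F := IsLocallyConstant.iff_eventually_eq _ |>.2 fun x =>
    eventually_eq_of_eventually_hasMFDerivAt_zero I I (Eventually.of_forall hF)
  rw [Subgroup.mem_center_iff]
  intro h
  have := hloc.apply_eq_of_preconnectedSpace h 1
  simp only [F] at this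
  have h2 : g * h * g⁻¹ * h⁻¹ = 1 := by simpa using this
  rw [mul_inv_eq_one, mul_inv_eq_iff_eq_mul] at h2
  exact h2.symm

end AdjointRepresentation

/-! ### Equivariance of `ad` under `Ad` -/

section AdjointDerivative

open Set Filter Topology

variable {E H : Type*} [NormedAddCommGroup E] [NormedSpace ℝ E] [TopologicalSpace H]
  (I : ModelWithCorners ℝ E H) [I.Boundaryless] (G : Type*) [Group G] [TopologicalSpace G]
  [ChartedSpace H G] [LieGroup I ∞ G]

/-- The derivative at `1` of the adjoint action of a Lie group. -/
noncomputable def adjointDeriv : E →L[ℝ] E →L[ℝ] E :=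
  fderiv ℝ (fun v : E => adjointAction I ((extChartAt I (1 : G)).symm v)) (extChartAt I (1 : G) 1)

theorem bracket_eq_adjointDeriv (y x : GroupLieAlgebra I G) : ⁅y, x⁆ = adjointDeriv I G y x :=
  bracket_eq_fderiv_adjointAction I y x

theorem hasFDerivAt_adjointAction :
    HasFDerivAt (fun v : E => adjointAction I ((extChartAt I (1 : G)).symm v))
      (adjointDeriv I G) (extChartAt I (1 : G) 1) :=
  ((contDiffAt_adjointAction_extChartAt_symm I (1 : G)).differentiableAt (by simp)).hasFDerivAt

variable {G}

theorem adjointAction_comp_inv (g : G) :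
    adjointAction I g ∘L adjointAction I g⁻¹ = ContinuousLinearMap.id ℝ E := by
  rw [← adjointAction_mul, mul_inv_cancel, adjointAction_one]

/-- Differentiate `Ad (g k g⁻¹) = Ad g ∘ Ad k ∘ Ad g⁻¹` in `k` at `1`. -/
theorem adjointDeriv_adjointAction (g : G) (v : E) :
    adjointDeriv I G (adjointAction I g v) =
      adjointAction I g ∘L adjointDeriv I G v ∘L adjointAction I g⁻¹ := by
  have := topologicalGroup_of_lieGroup I ∞ (G := G)
  set e := extChartAt I (1 : G) 1 with he
  have h1 : HasFDerivAt (fun v : E => adjointAction I ((extChartAt I (1 : G)).symm v))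
      (adjointDeriv I G) (conjChart I g e) := by
    rw [he, conjChart_base]; exact hasFDerivAt_adjointAction I G
  have h2 := HasFDerivAt.comp e h1 (differentiableAt_conjChart I g).hasFDerivAt
  have h3 : HasFDerivAt (fun v : E => adjointAction I g ∘L
      adjointAction I ((extChartAt I (1 : G)).symm v) ∘L adjointAction I g⁻¹)
      (((ContinuousLinearMap.compL ℝ E E E (adjointAction I g)) ∘L
        ((ContinuousLinearMap.compL ℝ E E E).flip (adjointAction I g⁻¹))) ∘L adjointDeriv I G) e :=
    ((ContinuousLinearMap.compL ℝ E E E (adjointAction I g)) ∘L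
      ((ContinuousLinearMap.compL ℝ E E E).flip (adjointAction I g⁻¹))).hasFDerivAt.comp e
      (hasFDerivAt_adjointAction I G)
  have heq : (fun v : E => adjointAction I ((extChartAt I (1 : G)).symm v)) ∘ conjChart I g
      =ᶠ[𝓝 e] fun v : E => adjointAction I g ∘L
        adjointAction I ((extChartAt I (1 : G)).symm v) ∘L adjointAction I g⁻¹ := by
    have hc : ContinuousAt (fun u : E => g * (extChartAt I (1 : G)).symm u * g⁻¹) e :=
      (continuousAt_const.mul (contMDiffAt_extChartAt_symm_self I (1 : G)).continuousAt).mul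
        continuousAt_const
    have hm := hc.preimage_mem_nhds (t := (extChartAt I (1 : G)).source)
      (by simpa [he] using extChartAt_source_mem_nhds (I := I) (1 : G))
    filter_upwards [hm] with u hu
    rw [Function.comp_apply, conjChart, (extChartAt I (1 : G)).left_inv hu, adjointAction_mul,
      adjointAction_mul]
    rfl
  exact DFunLike.congr_fun (h2.unique (h3.congr_of_eventuallyEq heq)) v

end AdjointDerivative

/-! ### Detecting the kernel of `Ad` with two elements of the Lie algebra -/

section Semisimple

open Set Filter Topology

variable {E H : Type*} [NormedAddCommGroup E] [NormedSpace ℝ E] [TopologicalSpace H]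
  [FiniteDimensional ℝ E] [CompleteSpace E]
  (I : ModelWithCorners ℝ E H) [I.Boundaryless] (G : Type*) [Group G] [TopologicalSpace G]
  [ChartedSpace H G] [LieGroup I ∞ G]
  [LieAlgebra.IsSemisimple ℝ (GroupLieAlgebra I G)]

theorem adjointDeriv_injective : Function.Injective (adjointDeriv I G) := by
  have key : ∀ v : GroupLieAlgebra I G, (∀ x : GroupLieAlgebra I G, ⁅v, x⁆ = 0) → v = 0 := by
    intro v hv
    have h : v ∈ LieAlgebra.center ℝ (GroupLieAlgebra I G) := fun x => by
      rw [← lie_skew, hv, neg_zero]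
    rwa [LieAlgebra.center_eq_bot] at h
  rw [injective_iff_map_eq_zero]
  intro v hv
  refine key v fun x => (bracket_eq_adjointDeriv I G v x).trans ?_
  exact DFunLike.congr_fun hv x

/-- There are two elements of a semisimple Lie algebra such that operators commuting with their
adjoint operators commute with all adjoint operators. -/
theorem LieAlgebra.IsKilling.exists_pair_forall_commute (K L : Type*) [Field K] [CharZero K]
    [LieRing L] [LieAlgebra K L] [FiniteDimensional K L] [LieAlgebra.IsKilling K L] :
    ∃ x y : L, ∀ T : L →ₗ[K] L, (∀ w : L, T ⁅x, w⁆ = ⁅x, T w⁆) →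
      (∀ w : L, T ⁅y, w⁆ = ⁅y, T w⁆) → ∀ v w : L, T ⁅v, w⁆ = ⁅v, T w⁆ := by
  obtain ⟨x, y, hxy⟩ := LieAlgebra.IsKilling.exists_lieSpan_pair_eq_top K L
  refine ⟨x, y, fun T hx hy v => ?_⟩
  have hv : v ∈ LieSubalgebra.lieSpan K L {x, y} := hxy ▸ LieSubalgebra.mem_top v
  -- The `v` with `ad v` commuting with `T` form a Lie subalgebra, so it is enough to test
  -- generators.
  refine LieSubalgebra.lieSpan_induction K
    (p := fun v _ => ∀ w : L, T ⁅v, w⁆ = ⁅v, T w⁆) ?_ ?_ ?_ ?_ ?_ hv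
  · rintro z (rfl | rfl)
    exacts [hx, hy]
  · simp
  · intro u v _ _ hu hv w
    simp [hu, hv]
  · intro a v _ hv w
    simp [hv]
  · intro u v _ _ hu hv w
    simp [hu, hv, lie_lie]

theorem exists_pair_adjointDeriv : ∃ x y : E, ∀ T : E →L[ℝ] E,
    (∀ w, T (adjointDeriv I G x w) = adjointDeriv I G x (T w)) →
    (∀ w, T (adjointDeriv I G y w) = adjointDeriv I G y (T w)) →
      ∀ v w, T (adjointDeriv I G v w) = adjointDeriv I G v (T w) := by
  have : Module.Finite ℝ (GroupLieAlgebra I G) := inferInstanceAs (Module.Finite ℝ E)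
  obtain ⟨x, y, h⟩ := LieAlgebra.IsKilling.exists_pair_forall_commute ℝ (GroupLieAlgebra I G)
  simp only [bracket_eq_adjointDeriv] at h
  exact ⟨x, y, fun T => h (T : E →ₗ[ℝ] E)⟩

theorem adjointDeriv_jacobi (u v w : E) :
    adjointDeriv I G (adjointDeriv I G u v) w =
      adjointDeriv I G u (adjointDeriv I G v w) - adjointDeriv I G v (adjointDeriv I G u w) := by
  have key : ∀ u v w : GroupLieAlgebra I G, ⁅u, ⁅v, w⁆⁆ = adjointDeriv I G u (adjointDeriv I G v w) :=
    fun u v w => (bracket_eq_adjointDeriv I G u _).trans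
      (congrArg (fun t : E => adjointDeriv I G u t) (bracket_eq_adjointDeriv I G v w))
  have key' : ∀ u v w : GroupLieAlgebra I G, ⁅⁅u, v⁆, w⁆ = adjointDeriv I G (adjointDeriv I G u v) w :=
    fun u v w => (bracket_eq_adjointDeriv I G _ w).trans
      (congrArg (fun t : E => adjointDeriv I G t w) (bracket_eq_adjointDeriv I G u v))
  exact (key' u v w).symm.trans ((lie_lie (L := GroupLieAlgebra I G) (M := GroupLieAlgebra I G)
    u v w).trans (congrArg₂ (fun a b : E => a - b) (key u v w) (key v u w)))

variable {I G} in
-- By Jacobi `ad [v, w] = 0` for every `w`; injectivity of `ad` gives first `[v, w] = 0`, then `v =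
-- 0`.
theorem eq_zero_of_adjointDeriv_commute {v : E}
    (h : ∀ w u, adjointDeriv I G v (adjointDeriv I G w u) =
      adjointDeriv I G w (adjointDeriv I G v u)) : v = 0 := by
  have h1 : ∀ w, adjointDeriv I G v w = 0 := fun w => by
    refine adjointDeriv_injective I G ?_
    ext u
    rw [adjointDeriv_jacobi, h, sub_self, map_zero]
    rfl
  refine adjointDeriv_injective I G ?_
  ext w
  rw [h1, map_zero]
  rfl

/-- The commutator of operators, `T ↦ T M - M T`. -/
noncomputable def ContinuousLinearMap.commutator (M : E →L[ℝ] E) : (E →L[ℝ] E) →L[ℝ] (E →L[ℝ] E) :=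
  (ContinuousLinearMap.compL ℝ E E E).flip M - ContinuousLinearMap.compL ℝ E E E M

theorem ContinuousLinearMap.commutator_apply (M T : E →L[ℝ] E) :
    ContinuousLinearMap.commutator M T = T ∘L M - M ∘L T := rfl

theorem ContinuousLinearMap.continuous_commutator :
    Continuous (ContinuousLinearMap.commutator : (E →L[ℝ] E) → _) :=
  ((ContinuousLinearMap.compL ℝ E E E).flip.continuous).sub
    (ContinuousLinearMap.compL ℝ E E E).continuous

/-- The pair of commutators with two operators. -/
noncomputable def ContinuousLinearMap.commutatorPair (P : (E →L[ℝ] E) × (E →L[ℝ] E)) :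
    (E →L[ℝ] E) →L[ℝ] (E →L[ℝ] E) × (E →L[ℝ] E) :=
  ContinuousLinearMap.inl ℝ _ _ ∘L ContinuousLinearMap.commutator P.1 +
    ContinuousLinearMap.inr ℝ _ _ ∘L ContinuousLinearMap.commutator P.2

theorem ContinuousLinearMap.commutatorPair_eq_zero_iff (P : (E →L[ℝ] E) × (E →L[ℝ] E))
    (T : E →L[ℝ] E) : ContinuousLinearMap.commutatorPair P T = 0 ↔
      T ∘L P.1 = P.1 ∘L T ∧ T ∘L P.2 = P.2 ∘L T := by
  simp [ContinuousLinearMap.commutatorPair, Prod.ext_iff, ContinuousLinearMap.commutator_apply,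
    sub_eq_zero]

theorem ContinuousLinearMap.continuous_commutatorPair :
    Continuous (ContinuousLinearMap.commutatorPair : (E →L[ℝ] E) × (E →L[ℝ] E) → _) :=
  (continuous_const.clm_comp (ContinuousLinearMap.continuous_commutator.comp continuous_fst)).add
    (continuous_const.clm_comp (ContinuousLinearMap.continuous_commutator.comp continuous_snd))

/-- If `Ad g` commutes with `ad x` and `ad y`, it commutes with every `ad v`, so `ad (Ad g v) = ad
v` by equivariance and `Ad g v = v`. The second clause is the infinitesimal version, needed for
stability under perturbation of the pair. -/
theorem exists_pair_adjointAction_eq_id : ∃ x y : E,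
    (∀ g : G, ContinuousLinearMap.commutatorPair (adjointDeriv I G x, adjointDeriv I G y)
      (adjointAction I g) = 0 → adjointAction I g = ContinuousLinearMap.id ℝ E) ∧
    Function.Injective (ContinuousLinearMap.commutatorPair
      (adjointDeriv I G x, adjointDeriv I G y) ∘L adjointDeriv I G) := by
  obtain ⟨x, y, h⟩ := exists_pair_adjointDeriv I G
  refine ⟨x, y, fun g hg => ?_, ?_⟩
  · obtain ⟨hx, hy⟩ := (ContinuousLinearMap.commutatorPair_eq_zero_iff _ _).1 hg
    have hall := h (adjointAction I g) (fun w => DFunLike.congr_fun hx w)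
      (fun w => DFunLike.congr_fun hy w)
    ext v : 1
    refine adjointDeriv_injective I G ?_
    ext w : 1
    rw [adjointDeriv_adjointAction]
    simp only [ContinuousLinearMap.comp_apply, hall]
    exact congrArg (adjointDeriv I G v) (DFunLike.congr_fun (adjointAction_comp_inv I g) w)
  · refine (injective_iff_map_eq_zero _).2 fun v hv => ?_
    obtain ⟨hx, hy⟩ := (ContinuousLinearMap.commutatorPair_eq_zero_iff _ _).1 hv
    exact eq_zero_of_adjointDeriv_commute (h (adjointDeriv I G v)
      (fun w => DFunLike.congr_fun hx w) (fun w => DFunLike.congr_fun hy w))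

end Semisimple

/-! ### Stability of isolated zeros -/

section Analysis

open Set Filter Topology

/-- Injectivity of `K₀ ∘ h'` in finite dimension gives a lower bound `‖v‖ ≤ C ‖K₀ (h' v)‖`. It
survives the first-order error of `h` and a small change of `K₀`, so the zero stays isolated on a
neighbourhood independent of the operator. -/
theorem HasFDerivAt.eventually_eq_of_apply_eq_zero {E F F' : Type*} [NormedAddCommGroup E]
    [NormedSpace ℝ E] [FiniteDimensional ℝ E] [NormedAddCommGroup F] [NormedSpace ℝ F]
    [NormedAddCommGroup F'] [NormedSpace ℝ F'] {h : E → F} {h' : E →L[ℝ] F} {e : E}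
    (hh : HasFDerivAt h h' e) (he : h e = 0) {K₀ : F →L[ℝ] F'}
    (hinj : Function.Injective (K₀ ∘L h')) :
    ∀ᶠ p : (F →L[ℝ] F') × E in 𝓝 (K₀, e), p.1 (h p.2) = 0 → p.2 = e := by
  obtain ⟨C, hC0, hC⟩ := (K₀ ∘L h').toLinearMap.exists_antilipschitzWith
    (LinearMap.ker_eq_bot.2 hinj)
  -- This product is the factor by which a zero `p.2 ≠ e` would have to bound `‖p.2 - e‖` by itself;
  -- a factor below `1` is absurd.
  obtain ⟨ε, hε0, hε⟩ : ∃ ε : ℝ, 0 < ε ∧ (C : ℝ) * ((‖K₀‖ + ε) * ε + ε * ‖h'‖) < 1 := by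
    have hlim : Tendsto (fun ε : ℝ => (C : ℝ) * ((‖K₀‖ + ε) * ε + ε * ‖h'‖)) (𝓝[>] 0) (𝓝 0) := by
      have : ContinuousAt (fun ε : ℝ => (C : ℝ) * ((‖K₀‖ + ε) * ε + ε * ‖h'‖)) 0 := by fun_prop
      have h0 := this.tendsto
      simp only [add_zero, mul_zero, zero_mul] at h0
      exact h0.mono_left nhdsWithin_le_nhds
    obtain ⟨ε, h1, h2⟩ := ((hlim.eventually (gt_mem_nhds one_pos)).and self_mem_nhdsWithin).exists
    exact ⟨ε, h2, h1⟩
  have hlo := hh.isLittleO.def hε0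
  rw [nhds_prod_eq]
  filter_upwards [(Metric.ball_mem_nhds K₀ hε0 |> fun h => Filter.prod_mem_prod h hlo)]
    with p hp hp0
  obtain ⟨h1, h2⟩ := hp
  have h1' : ‖p.1 - K₀‖ < ε := by simpa [dist_eq_norm] using h1
  have h2' : ‖h p.2 - h e - h' (p.2 - e)‖ ≤ ε * ‖p.2 - e‖ := h2
  rw [he, sub_zero] at h2'
  have h3 : ‖p.2 - e‖ ≤ C * ‖K₀ (h' (p.2 - e))‖ := by
    simpa using hC.le_mul_dist (p.2 - e) 0
  have h4 : K₀ (h' (p.2 - e)) = -(p.1 (h p.2 - h' (p.2 - e)) + (p.1 - K₀) (h' (p.2 - e))) := by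
    simp [hp0]
  have hp1 : ‖p.1‖ ≤ ‖K₀‖ + ε := by
    have := norm_add_le (p.1 - K₀) K₀
    rw [sub_add_cancel] at this
    linarith
  have h5 : ‖K₀ (h' (p.2 - e))‖ ≤ ((‖K₀‖ + ε) * ε + ε * ‖h'‖) * ‖p.2 - e‖ := by
    rw [h4, norm_neg]
    calc _ ≤ ‖p.1 (h p.2 - h' (p.2 - e))‖ + ‖(p.1 - K₀) (h' (p.2 - e))‖ := norm_add_le _ _
      _ ≤ (‖K₀‖ + ε) * (ε * ‖p.2 - e‖) + ε * (‖h'‖ * ‖p.2 - e‖) := by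
        refine add_le_add ?_ ?_
        · exact p.1.le_of_opNorm_le_of_le hp1 h2'
        · exact (p.1 - K₀).le_of_opNorm_le_of_le h1'.le (h'.le_opNorm _)
      _ = _ := by ring
  by_contra hne
  have hpos : 0 < ‖p.2 - e‖ := norm_pos_iff.2 (sub_ne_zero.2 hne)
  have : ‖p.2 - e‖ ≤ (C * ((‖K₀‖ + ε) * ε + ε * ‖h'‖)) * ‖p.2 - e‖ := by
    refine h3.trans ?_
    rw [mul_assoc]
    exact mul_le_mul_of_nonneg_left h5 C.2
  nlinarith

end Analysis

/-! ### Finiteness of the center, and pairs near `1` with central centralizer -/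

section CommutingPairs

open Set Filter Topology

variable {E H : Type*} [NormedAddCommGroup E] [NormedSpace ℝ E] [TopologicalSpace H]
  [FiniteDimensional ℝ E] [CompleteSpace E]
  (I : ModelWithCorners ℝ E H) [I.Boundaryless] (G : Type*) [Group G] [TopologicalSpace G]
  [ChartedSpace H G] [LieGroup I ∞ G]
  [LieAlgebra.IsSemisimple ℝ (GroupLieAlgebra I G)]

theorem eventually_adjointAction_eq_id :
    ∀ᶠ g : G in 𝓝 1, adjointAction I g = ContinuousLinearMap.id ℝ E → g = 1 := by
  have h := (hasFDerivAt_adjointAction I G).sub_const (ContinuousLinearMap.id ℝ E)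
  have h2 := h.eventually_eq_of_apply_eq_zero (K₀ := ContinuousLinearMap.id ℝ (E →L[ℝ] E))
    (by rw [extChartAt_to_inv, adjointAction_one, sub_self]) (adjointDeriv_injective I G)
  have hc : ContinuousAt (fun g : G =>
      (ContinuousLinearMap.id ℝ (E →L[ℝ] E), extChartAt I (1 : G) g)) 1 :=
    continuousAt_const.prodMk (continuousAt_extChartAt (1 : G))
  filter_upwards [hc.eventually h2, extChartAt_source_mem_nhds (I := I) (1 : G)] with g hg hgs hid
  refine (extChartAt I (1 : G)).injOn hgs (mem_extChartAt_source (1 : G)) (hg ?_)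
  rw [(extChartAt I (1 : G)).left_inv hgs, hid, sub_self, map_zero]

include I in
-- The center is closed, hence compact. Central elements act trivially by `Ad`, which no element
-- near `1` other than `1` does, so the center is discrete.
theorem finite_center [T2Space G] [CompactSpace G] : Finite (Subgroup.center G) := by
  have := topologicalGroup_of_lieGroup I ∞ (G := G)
  have hclosed : IsClosed (Subgroup.center G : Set G) := by
    have : (Subgroup.center G : Set G) = ⋂ h : G, {g | h * g = g * h} := by
      ext g
      simp [Subgroup.mem_center_iff]
    rw [this]
    exact isClosed_iInter fun h =>
      isClosed_eq (continuous_const.mul continuous_id) (continuous_id.mul continuous_const)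
  have : CompactSpace (Subgroup.center G) :=
    isCompact_iff_compactSpace.1 hclosed.isCompact
  have : DiscreteTopology (Subgroup.center G) := by
    refine discreteTopology_of_isOpen_singleton_one ?_
    have h : ∀ᶠ z : Subgroup.center G in 𝓝 1, z = 1 := by
      have hc : Tendsto (Subtype.val : Subgroup.center G → G) (𝓝 1) (𝓝 1) :=
        continuous_subtype_val.tendsto _
      filter_upwards [hc.eventually (eventually_adjointAction_eq_id I G)] with z hz
      exact Subtype.ext (hz (adjointAction_of_mem_center I z.2))
    exact (isOpen_singleton_iff_nhds_eq_pure 1).2 (le_antisymm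
      (le_pure_iff.2 (h.mono fun z hz => hz)) (pure_le_nhds 1))
  exact finite_of_compact_of_discrete

theorem adjointAction_center_mul {z : G} (hz : z ∈ Subgroup.center G) (g : G) :
    adjointAction I (z * g) = adjointAction I g := by
  rw [adjointAction_mul, adjointAction_of_mem_center I hz]
  rfl

/-- The condition on `P` is checked near each group element and made uniform by compactness of `G`.
-/
theorem exists_pair_eventually_mem_center [ConnectedSpace G] [CompactSpace G] : ∃ x y : E,
    ∀ᶠ P in 𝓝 (adjointDeriv I G x, adjointDeriv I G y), ∀ g : G,
      ContinuousLinearMap.commutatorPair P (adjointAction I g) = 0 → g ∈ Subgroup.center G := by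
  have := topologicalGroup_of_lieGroup I ∞ (G := G)
  obtain ⟨x, y, hxy, hinj⟩ := exists_pair_adjointAction_eq_id I G
  refine ⟨x, y, ?_⟩
  set P₀ := (adjointDeriv I G x, adjointDeriv I G y)
  have hcont : Continuous fun p : ((E →L[ℝ] E) × (E →L[ℝ] E)) × G =>
      ContinuousLinearMap.commutatorPair p.1 (adjointAction I p.2) :=
    (ContinuousLinearMap.continuous_commutatorPair.comp continuous_fst).clm_apply
      ((continuous_adjointAction I).comp continuous_snd)
  have hloc : ∀ g₀ ∈ (univ : Set G), ∀ᶠ p : ((E →L[ℝ] E) × (E →L[ℝ] E)) × G in 𝓝 (P₀, g₀),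
      ContinuousLinearMap.commutatorPair p.1 (adjointAction I p.2) = 0 →
        p.2 ∈ Subgroup.center G := by
    intro g₀ _
    -- Near a central `g₀`, translation by `g₀⁻¹` leaves `Ad` unchanged and the isolated zero at `1`
    -- applies. Near a noncentral one the commutators are nonzero, an open condition.
    by_cases hg₀ : g₀ ∈ Subgroup.center G
    · have h := (hasFDerivAt_adjointAction I G).sub_const (ContinuousLinearMap.id ℝ E)
      have h2 := h.eventually_eq_of_apply_eq_zero
        (by rw [extChartAt_to_inv, adjointAction_one, sub_self]) hinj
      have hm : ContinuousAt (fun p : ((E →L[ℝ] E) × (E →L[ℝ] E)) × G => g₀⁻¹ * p.2) (P₀, g₀) := by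
        fun_prop
      have hm1 : Tendsto (fun p : ((E →L[ℝ] E) × (E →L[ℝ] E)) × G => g₀⁻¹ * p.2) (𝓝 (P₀, g₀))
          (𝓝 1) := by
        simpa [ContinuousAt] using hm
      have hc : Tendsto (fun p : ((E →L[ℝ] E) × (E →L[ℝ] E)) × G =>
          (ContinuousLinearMap.commutatorPair p.1, extChartAt I (1 : G) (g₀⁻¹ * p.2)))
          (𝓝 (P₀, g₀)) (𝓝 (ContinuousLinearMap.commutatorPair P₀, extChartAt I (1 : G) 1)) :=
        ((ContinuousLinearMap.continuous_commutatorPair.comp continuous_fst).tendsto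
          (P₀, g₀)).prodMk_nhds ((continuousAt_extChartAt (1 : G)).tendsto.comp hm1)
      filter_upwards [hc.eventually h2,
        hm1.eventually (extChartAt_source_mem_nhds (I := I) (1 : G))] with p hp hps hp0
      have h1 : g₀⁻¹ * p.2 = 1 := by
        refine (extChartAt I (1 : G)).injOn hps (mem_extChartAt_source (1 : G)) (hp ?_)
        rw [(extChartAt I (1 : G)).left_inv hps, adjointAction_center_mul I G (inv_mem hg₀), map_sub,
          hp0, zero_sub, neg_eq_zero, ContinuousLinearMap.commutatorPair_eq_zero_iff]
        exact ⟨rfl, rfl⟩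
      rw [inv_mul_eq_one] at h1
      exact h1 ▸ hg₀
    · have h1 : ContinuousLinearMap.commutatorPair P₀ (adjointAction I g₀) ≠ 0 := fun h0 =>
        hg₀ (mem_center_of_adjointAction_eq_id I (hxy g₀ h0))
      filter_upwards [hcont.continuousAt.eventually_ne h1] with p hp h0
      exact absurd h0 hp
  filter_upwards [isCompact_univ.eventually_forall_of_forall_eventually
    (P := fun P g => ContinuousLinearMap.commutatorPair P (adjointAction I g) = 0 →
      g ∈ Subgroup.center G) hloc] with P hP g
  exact hP g trivial

include I in
-- For short chart segments `a` in the directions `x` and `y`, the quotients `(Ad (a t) - 1) / t`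
-- tend to `ad x` and `ad y`. If `g` commutes with both points, `Ad g` commutes with both quotients,
-- and these lie in the good neighbourhood for small `t ≠ 0`.
theorem exists_pair_centralizer_le_center [ConnectedSpace G] [CompactSpace G] {U : Set G}
    (hU : U ∈ 𝓝 (1 : G)) : ∃ a ∈ U, ∃ b ∈ U, ∀ g : G, g * a = a * g → g * b = b * g →
      g ∈ Subgroup.center G := by
  obtain ⟨x, y, hxy⟩ := exists_pair_eventually_mem_center I G
  set e := extChartAt I (1 : G) 1 with he
  let a : E → ℝ → G := fun x t => (extChartAt I (1 : G)).symm (e + t • x)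
  let M : E → ℝ → (E →L[ℝ] E) := fun x t =>
    t⁻¹ • (adjointAction I (a x t) - ContinuousLinearMap.id ℝ E)
  have hline : ∀ x : E, HasDerivAt (fun t : ℝ => e + t • x) x 0 := fun x => by
    simpa using ((hasDerivAt_id (0 : ℝ)).smul_const x).const_add e
  have hM : ∀ x, Tendsto (M x) (𝓝[≠] 0) (𝓝 (adjointDeriv I G x)) := by
    intro x
    have h1 : HasFDerivAt (fun v : E => adjointAction I ((extChartAt I (1 : G)).symm v))
        (adjointDeriv I G) (e + (0 : ℝ) • x) := by
      rw [zero_smul, add_zero]; exact hasFDerivAt_adjointAction I G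
    have h2 := hasDerivAt_iff_tendsto_slope.1 (h1.comp_hasDerivAt (0 : ℝ) (hline x))
    refine h2.congr fun t => ?_
    simp only [slope_def_module, Function.comp_apply, sub_zero, M, a, zero_smul, add_zero]
    rw [he, extChartAt_to_inv, adjointAction_one]
  have ha : ∀ x, Tendsto (a x) (𝓝[≠] 0) (𝓝 1) := by
    intro x
    have h1 : ContinuousAt (extChartAt I (1 : G)).symm (e + (0 : ℝ) • x) := by
      rw [zero_smul, add_zero]; exact continuousAt_extChartAt_symm 1
    have h2 : ContinuousAt (a x) 0 :=
      ContinuousAt.comp (f := fun t : ℝ => e + t • x) (x := (0 : ℝ)) h1 (hline x).continuousAt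
    have h3 : a x 0 = 1 := by simp only [a, zero_smul, add_zero]; exact extChartAt_to_inv 1
    exact h3 ▸ h2.tendsto.mono_left nhdsWithin_le_nhds
  obtain ⟨t, ht, hax, hay⟩ := ((((hM x).prodMk_nhds (hM y)).eventually hxy).and
    (((ha x).eventually hU).and ((ha y).eventually hU))).exists
  refine ⟨_, hax, _, hay, fun g hgx hgy => ht g ?_⟩
  have hcomm : ∀ x, g * a x t = a x t * g → adjointAction I g ∘L M x t = M x t ∘L adjointAction I g := by
    intro x hx
    simp only [M, ContinuousLinearMap.comp_smul, ContinuousLinearMap.smul_comp,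
      ContinuousLinearMap.comp_sub, ContinuousLinearMap.sub_comp, ← adjointAction_mul, hx,
      ContinuousLinearMap.comp_id, ContinuousLinearMap.id_comp]
  exact (ContinuousLinearMap.commutatorPair_eq_zero_iff _ _).2 ⟨hcomm x hgx, hcomm y hgy⟩

end CommutingPairs

/-! ### Square roots near the identity -/

section SquareRoots

open Set Filter Topology

variable {E H : Type*} [NormedAddCommGroup E] [NormedSpace ℝ E] [TopologicalSpace H]
  [CompleteSpace E]
  (I : ModelWithCorners ℝ E H) [I.Boundaryless] (G : Type*) [Group G] [TopologicalSpace G]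
  [ChartedSpace H G] [LieGroup I ∞ G]

include I in
-- Squaring has derivative `2` at `1`, so it maps neighbourhoods of `1` onto neighbourhoods of `1`.
theorem eventually_exists_mul_self_eq : ∀ᶠ y : G in 𝓝 1, ∃ c, c * c = y := by
  have := topologicalGroup_of_lieGroup I ∞ (G := G)
  set e := extChartAt I (1 : G) 1 with he
  have hs : HasStrictFDerivAt (fun u : E => mulChart I G (u, u)) ((2 : ℝ) • ContinuousLinearMap.id ℝ E) e := by
    have hm : HasStrictFDerivAt (mulChart I G)
        (ContinuousLinearMap.fst ℝ E E + ContinuousLinearMap.snd ℝ E E) (e, e) := by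
      have h := (contDiffAt_mulChart I (G := G)).hasStrictFDerivAt (by simp)
      rwa [(hasFDerivAt_mulChart I).fderiv] at h
    have h := HasStrictFDerivAt.comp e (f := fun u : E => (u, u)) hm
      ((hasStrictFDerivAt_id e).prodMk (hasStrictFDerivAt_id e))
    convert! h using 1
    ext v
    simp [two_smul]
  have hsurj : ((2 : ℝ) • ContinuousLinearMap.id ℝ E).range = ⊤ := by
    rw [LinearMap.range_eq_top]
    exact fun v => ⟨(2 : ℝ)⁻¹ • v, by simp⟩
  have hmap := hs.map_nhds_eq_of_surj hsurj
  have hee : mulChart I G (e, e) = e := by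
    rw [mulChart, he, extChartAt_to_inv, mul_one]
  rw [hee] at hmap
  have hcs : ContinuousAt (extChartAt I (1 : G)).symm e := continuousAt_extChartAt_symm 1
  have hcm : ContinuousAt (fun u : E => (extChartAt I (1 : G)).symm u *
    (extChartAt I (1 : G)).symm u) e := hcs.mul hcs
  have hN : {u : E | (extChartAt I (1 : G)).symm u * (extChartAt I (1 : G)).symm u ∈
      (extChartAt I (1 : G)).source} ∈ 𝓝 e :=
    hcm.preimage_mem_nhds (by
      simp only [he, extChartAt_to_inv, mul_one]
      exact extChartAt_source_mem_nhds (I := I) (1 : G))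
  have himg := Filter.image_mem_map (m := fun u : E => mulChart I G (u, u)) hN
  rw [hmap] at himg
  filter_upwards [(continuousAt_extChartAt (I := I) (1 : G)).preimage_mem_nhds himg,
    extChartAt_source_mem_nhds (I := I) (1 : G)] with y ⟨u, hu, huy⟩ hys
  exact ⟨_, (extChartAt I (1 : G)).injOn hu hys huy⟩

end SquareRoots

/-! ### Fibres of the natural map and central 2-torsion -/

section ModuliAlgebra

variable {S : NonorientableSurface} {G : Type*} [Group G]

theorem FlatCover.isGeneric_iff (p : FlatCover S G) :
    p.IsGeneric ↔ ∀ k : G × G, k • p = p ↔ k.1 = k.2 ∧ k.1 ∈ Subgroup.center G := by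
  rw [FlatCover.IsGeneric, Subgroup.ext_iff]
  refine forall_congr' fun k => ?_
  rw [MulAction.mem_stabilizer_iff]
  refine iff_congr Iff.rfl ⟨?_, ?_⟩
  · rintro ⟨z, hz, rfl⟩
    exact ⟨rfl, hz⟩
  · rintro ⟨h1, h2⟩
    exact ⟨k.1, h2, Prod.ext rfl h1⟩

/-- The stabilizer changes by conjugation, which fixes the diagonal center pointwise. -/
theorem FlatCover.IsGeneric.smul {p : FlatCover S G} (hp : p.IsGeneric) (k : G × G) :
    (k • p).IsGeneric := by
  rw [FlatCover.isGeneric_iff] at hp ⊢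
  intro m
  have h1 : m • k • p = k • p ↔ (k⁻¹ * m * k) • p = p := by
    rw [mul_smul, mul_smul, inv_smul_eq_iff]
  rw [h1, hp]
  simp only [Prod.fst_mul, Prod.snd_mul, Prod.fst_inv, Prod.snd_inv]
  constructor
  · rintro ⟨h2, h3⟩
    have h4 : m.1 = k.1⁻¹ * m.1 * k.1 := by
      have := Subgroup.mem_center_iff.1 h3 k.1
      rw [← mul_left_inj k.1⁻¹] at this
      simpa [mul_assoc] using this
    have h5 : m.2 = k.2⁻¹ * m.2 * k.2 := by
      have := Subgroup.mem_center_iff.1 (h2 ▸ h3) k.2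
      rw [← mul_left_inj k.2⁻¹] at this
      simpa [mul_assoc] using this
    rw [← h4] at h3
    exact ⟨by rw [h4, h2, ← h5], h3⟩
  · rintro ⟨h2, h3⟩
    have h4 : k.1⁻¹ * m.1 * k.1 = m.1 := by
      rw [mul_assoc, ← Subgroup.mem_center_iff.1 h3 k.1, inv_mul_cancel_left]
    have h5 : k.2⁻¹ * m.2 * k.2 = m.2 := by
      rw [mul_assoc, ← Subgroup.mem_center_iff.1 (h2 ▸ h3) k.2, inv_mul_cancel_left]
    rw [h4, h5]
    exact ⟨h2, h3⟩

theorem FlatCover.cls_eq_cls_iff {p q : FlatCover S G} :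
    p.cls = q.cls ↔ ∃ k : G × G, k • q = p := Quotient.eq

theorem FlatBase.cls_eq_cls_iff {x y : FlatBase S G} :
    x.cls = y.cls ↔ ∃ g : G, g • y = x := Quotient.eq

theorem FlatBase.exists_cls (q : ModuliBase S G) : ∃ x : FlatBase S G, x.cls = q :=
  Quotient.exists_rep q

theorem FlatCover.IsGeneric.of_cls_eq {p q : FlatCover S G} (hp : p.IsGeneric)
    (h : p.cls = q.cls) : q.IsGeneric := by
  obtain ⟨k, hk⟩ := FlatCover.cls_eq_cls_iff.1 h.symm
  exact hk ▸ hp.smul k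

theorem naturalMap_cls (x : FlatBase S G) : (naturalMap x.cls).1 = x.pullback.cls := rfl

theorem cls_mem_genericBase_iff {x : FlatBase S G} :
    x.cls ∈ genericBase S G ↔ x.pullback.IsGeneric := by
  refine ⟨?_, fun h => ⟨x, h, rfl⟩⟩
  rintro ⟨y, hy, hyx⟩
  exact hy.of_cls_eq (by rw [← naturalMap_cls, ← naturalMap_cls, hyx])

theorem mem_genericFixed_iff {p : FlatCover S G} (h : p.cls ∈ fixedLocus S G) :
    (⟨p.cls, h⟩ : fixedLocus S G) ∈ genericFixed S G ↔ p.IsGeneric := by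
  refine ⟨?_, fun hp => ⟨p, hp, rfl⟩⟩
  rintro ⟨q, hq, hqp⟩
  exact hq.of_cls_eq hqp

theorem naturalMap_mem_genericFixed_iff {q : ModuliBase S G} :
    naturalMap q ∈ genericFixed S G ↔ q ∈ genericBase S G := by
  obtain ⟨x, rfl⟩ := FlatBase.exists_cls q
  rw [cls_mem_genericBase_iff]
  exact mem_genericFixed_iff (naturalMap x.cls).2

/-- Multiplication of the holonomy `c` by a central element of order at most two. -/
def FlatBase.twist (x : FlatBase S G) (z : G) (hz : z ∈ Subgroup.center G) (hz2 : z * z = 1) :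
    FlatBase S G :=
  ⟨(x.1.1, z * x.1.2), by
    have h := x.2
    have hc : ∀ u, u * z = z * u := Subgroup.mem_center_iff.1 hz
    cases S with
    | projective l =>
      change x.1.commProd = z * x.1.2 * (z * x.1.2)
      have h1 : x.1.commProd = x.1.2 * x.1.2 := h
      rw [h1]
      symm
      calc z * x.1.2 * (z * x.1.2) = z * (x.1.2 * z) * x.1.2 := by group
        _ = z * z * (x.1.2 * x.1.2) := by rw [hc x.1.2]; group
        _ = x.1.2 * x.1.2 := by rw [hz2, one_mul]
    | klein l =>
      change x.1.commProd = z * x.1.2 * x.1.d * (z * x.1.2)⁻¹ * x.1.d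
      have h1 : x.1.commProd = x.1.2 * x.1.d * x.1.2⁻¹ * x.1.d := h
      rw [h1, mul_inv_rev, ← mul_assoc _ x.1.2⁻¹, mul_assoc z, mul_assoc z, ← hc]
      group⟩

/-- The gauge transformation `(z, 1)` multiplies one copy of `c` by `z` and the other by `z⁻¹ = z`.
-/
theorem FlatBase.naturalMap_twist (x : FlatBase S G) (z : G) (hz : z ∈ Subgroup.center G)
    (hz2 : z * z = 1) : naturalMap (x.twist z hz hz2).cls = naturalMap x.cls := by
  refine Subtype.ext (FlatCover.cls_eq_cls_iff.2 ⟨(z, 1), ?_⟩)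
  have hc : ∀ u, u * z = z * u := Subgroup.mem_center_iff.1 hz
  have hzi : z⁻¹ = z := inv_eq_of_mul_eq_one_left hz2
  refine Subtype.ext (Prod.ext (Prod.ext (funext fun i => ?_) ?_) (Prod.ext (funext fun i => ?_) ?_))
  · change z * x.1.1 i * z⁻¹ = x.1.1 i
    rw [← hc, mul_inv_cancel_right]
  · change z * x.1.2 * 1⁻¹ = z * x.1.2
    simp
  · change 1 * x.1.1 i * 1⁻¹ = x.1.1 i
    simp
  · change 1 * x.1.2 * z⁻¹ = z * x.1.2
    rw [hzi, one_mul, hc]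

theorem FlatBase.exists_twist_of_naturalMap_eq {x : FlatBase S G} (hx : x.pullback.IsGeneric)
    {q : ModuliBase S G} (hq : naturalMap q = naturalMap x.cls) :
    ∃ (z : G) (hz : z ∈ Subgroup.center G) (hz2 : z * z = 1), (x.twist z hz hz2).cls = q := by
  obtain ⟨y, rfl⟩ := FlatBase.exists_cls q
  obtain ⟨⟨g, h⟩, hk⟩ := FlatCover.cls_eq_cls_iff.1 (congrArg Subtype.val hq)
  have h1 : x.1.gauge g h = y.1 := congrArg (fun p : FlatCover S G => p.1.1) hk
  have h2 : x.1.gauge h g = y.1 := congrArg (fun p : FlatCover S G => p.1.2) hk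
  -- Both halves of a pullback agree, so `(g, h)` and `(h, g)` have the same effect here.
  have hs : ((h⁻¹ * g, g⁻¹ * h) : G × G) • x.pullback = x.pullback := by
    refine Subtype.ext (Prod.ext ?_ ?_)
    · change x.1.gauge (h⁻¹ * g) (g⁻¹ * h) = x.1
      rw [Holonomy.gauge_mul, h1, ← h2, ← Holonomy.gauge_mul]
      simp [Holonomy.gauge_one]
    · change x.1.gauge (g⁻¹ * h) (h⁻¹ * g) = x.1
      rw [Holonomy.gauge_mul, h2, ← h1, ← Holonomy.gauge_mul]
      simp [Holonomy.gauge_one]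
  obtain ⟨h3, h4⟩ := ((FlatCover.isGeneric_iff _).1 hx _).1 hs
  simp only at h3 h4
  have hc : ∀ u, u * (h⁻¹ * g) = (h⁻¹ * g) * u := Subgroup.mem_center_iff.1 h4
  refine ⟨h⁻¹ * g, h4, by nth_rw 2 [h3]; group, ?_⟩
  refine FlatBase.cls_eq_cls_iff.2 ⟨h⁻¹, ?_⟩
  refine Subtype.ext ?_
  change y.1.gauge h⁻¹ h⁻¹ = _
  rw [← h1, ← Holonomy.gauge_mul]
  refine Prod.ext (funext fun i => ?_) ?_
  · change h⁻¹ * g * x.1.1 i * (h⁻¹ * g)⁻¹ = x.1.1 i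
    rw [← hc, mul_inv_cancel_right]
  · change h⁻¹ * g * x.1.2 * (h⁻¹ * h)⁻¹ = h⁻¹ * g * x.1.2
    simp

/-- A conjugation by `g` between the two twists fixes `V` and multiplies `c` by `wz`. Then `(g,
wzg)` stabilizes the pullback, and genericity forces `wz = 1`. -/
theorem FlatBase.twist_cls_injective {x : FlatBase S G} (hx : x.pullback.IsGeneric)
    {z w : G} {hz : z ∈ Subgroup.center G} {hw : w ∈ Subgroup.center G} {hz2 : z * z = 1}
    {hw2 : w * w = 1} (h : (x.twist z hz hz2).cls = (x.twist w hw hw2).cls) : z = w := by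
  obtain ⟨g, hg⟩ := FlatBase.cls_eq_cls_iff.1 h
  have h1 : ∀ i, g * x.1.1 i * g⁻¹ = x.1.1 i := fun i =>
    congrArg (fun p : FlatBase S G => p.1.1 i) hg
  have h2 : g * (w * x.1.2) * g⁻¹ = z * x.1.2 := congrArg (fun p : FlatBase S G => p.1.2) hg
  have hcz : ∀ u, u * z = z * u := Subgroup.mem_center_iff.1 hz
  have hcw : ∀ u, u * w = w * u := Subgroup.mem_center_iff.1 hw
  have hzi : z⁻¹ = z := inv_eq_of_mul_eq_one_left hz2
  have hwi : w⁻¹ = w := inv_eq_of_mul_eq_one_left hw2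
  have h3 : g * x.1.2 * g⁻¹ = w * z * x.1.2 := by
    have : w * (g * (w * x.1.2) * g⁻¹) = w * (z * x.1.2) := by rw [h2]
    rw [← mul_assoc g, hcw, mul_assoc w, mul_assoc w, ← mul_assoc w w, hw2, one_mul] at this
    rw [this, mul_assoc]
  have hu : w * z ∈ Subgroup.center G := mul_mem hw hz
  have hcu : ∀ u, u * (w * z) = w * z * u := Subgroup.mem_center_iff.1 hu
  have hu2 : w * z * (w * z) = 1 := by
    rw [← mul_assoc, mul_assoc w z w, hcw, ← mul_assoc, hw2, one_mul, hz2]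
  have hui : (w * z)⁻¹ = w * z := inv_eq_of_mul_eq_one_left hu2
  have hconj : ∀ v, w * z * g * v * (w * z * g)⁻¹ = g * v * g⁻¹ := by
    intro v
    rw [mul_inv_rev, mul_assoc (w * z), mul_assoc (w * z), ← hcu]
    group
  have hs : ((g, w * z * g) : G × G) • x.pullback = x.pullback := by
    refine Subtype.ext (Prod.ext (Prod.ext (funext fun i => h1 i) ?_)
      (Prod.ext (funext fun i => ?_) ?_))
    · change g * x.1.2 * (w * z * g)⁻¹ = x.1.2
      rw [mul_inv_rev, ← mul_assoc, h3, hui, hcu, ← mul_assoc, hu2, one_mul]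
    · change w * z * g * x.1.1 i * (w * z * g)⁻¹ = x.1.1 i
      rw [hconj, h1]
    · change w * z * g * x.1.2 * g⁻¹ = x.1.2
      rw [mul_assoc (w * z), mul_assoc (w * z), h3, ← mul_assoc, hu2, one_mul]
  obtain ⟨h4, -⟩ := ((FlatCover.isGeneric_iff _).1 hx _).1 hs
  simp only at h4
  have h5 : w * z = 1 := by
    rw [eq_comm, mul_eq_right] at h4
    exact h4
  rw [← hwi, eq_comm, inv_eq_iff_mul_eq_one, h5]

variable (G) in
/-- Squaring, as an endomorphism of the center. -/
def centerSquare : Subgroup.center G →* Subgroup.center G where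
  toFun z := z ^ 2
  map_one' := one_pow 2
  map_mul' u v := (show Commute u v from
    Subtype.ext (Subgroup.mem_center_iff.1 v.2 u.1)).mul_pow 2

theorem twoCenter_eq_range : twoCenter G = (centerSquare G).range :=
  Subgroup.ext fun _ => Iff.rfl

/-- An endomorphism of a finite abelian group has kernel and cokernel of the same size. -/
theorem card_two_torsion_center [Finite (Subgroup.center G)] :
    Nat.card (centerSquare G).ker =
      Nat.card (Subgroup.center G ⧸ twoCenter G) := by
  have h1 := (centerSquare G).ker.card_mul_index
  have h2 := (centerSquare G).range.card_mul_index
  rw [Subgroup.index_ker] at h1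
  rw [← h1, mul_comm, Subgroup.index] at h2
  rw [twoCenter_eq_range]
  exact (Nat.eq_of_mul_eq_mul_right Nat.card_pos h2).symm

theorem ncard_fiber_naturalMap [Finite (Subgroup.center G)] {q : ModuliBase S G}
    (hq : q ∈ genericBase S G) : (naturalMap ⁻¹' {naturalMap q}).ncard =
      Nat.card (Subgroup.center G ⧸ twoCenter G) := by
  obtain ⟨x, hx, rfl⟩ := hq
  rw [← card_two_torsion_center, ← Nat.card_coe_set_eq]
  have hker : ∀ z : (centerSquare G).ker, (z : G) * (z : G) = 1 := by
    intro z
    have : (z : G) ^ 2 = 1 := congrArg Subtype.val (MonoidHom.mem_ker.1 z.2)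
    rwa [sq] at this
  refine (Nat.card_congr (Equiv.ofBijective (fun z => ⟨(x.twist z z.1.2 (hker z)).cls,
    x.naturalMap_twist _ _ _⟩) ⟨?_, ?_⟩)).symm
  · intro z w h
    exact Subtype.ext (Subtype.ext (FlatBase.twist_cls_injective hx (congrArg Subtype.val h)))
  · rintro ⟨r, hr⟩
    obtain ⟨z, hz, hz2, hzr⟩ := FlatBase.exists_twist_of_naturalMap_eq hx hr
    exact ⟨⟨⟨z, hz⟩, MonoidHom.mem_ker.2 (Subtype.ext ((sq z).trans hz2))⟩, Subtype.ext hzr⟩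

end ModuliAlgebra

/-! ### Centers of odd order: normal form of fixed points, bijectivity -/

section OddCenter

variable {S : NonorientableSurface} {G : Type*} [Group G]

theorem eq_one_of_mul_self_of_odd (hodd : Odd (Nat.card (Subgroup.center G))) {z : G}
    (hz : z ∈ Subgroup.center G) (hz2 : z * z = 1) : z = 1 := by
  obtain ⟨k, hk⟩ := hodd
  have h : (⟨z, hz⟩ : Subgroup.center G) ^ Nat.card (Subgroup.center G) = 1 := pow_card_eq_one'
  have h1 : z ^ (2 * k + 1) = 1 := by
    rw [← hk]; exact congrArg Subtype.val h
  rwa [pow_succ, pow_mul, sq, hz2, one_pow, one_mul] at h1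

theorem exists_mul_self_of_odd (hodd : Odd (Nat.card (Subgroup.center G))) {z : G}
    (hz : z ∈ Subgroup.center G) : ∃ w ∈ Subgroup.center G, w * w = z := by
  obtain ⟨k, hk⟩ := hodd
  have h : (⟨z, hz⟩ : Subgroup.center G) ^ Nat.card (Subgroup.center G) = 1 := pow_card_eq_one'
  have h1 : z ^ (2 * k + 1) = 1 := by
    rw [← hk]; exact congrArg Subtype.val h
  refine ⟨z ^ (k + 1), pow_mem hz _, ?_⟩
  rw [← pow_add, show k + 1 + (k + 1) = 2 * k + 1 + 1 by ring, pow_succ, h1, one_mul]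

theorem odd_card_center_of_forall [Finite (Subgroup.center G)]
    (h : ∀ z ∈ Subgroup.center G, z * z = 1 → z = 1) : Odd (Nat.card (Subgroup.center G)) := by
  by_contra hodd
  rw [Nat.not_odd_iff_even, even_iff_two_dvd] at hodd
  obtain ⟨z, hz⟩ := exists_prime_orderOf_dvd_card' 2 hodd
  have h2 : z ^ 2 = 1 := hz ▸ pow_orderOf_eq_one z
  have h3 : z = 1 := Subtype.ext (h z z.2 ((sq (z : G)).symm.trans (congrArg Subtype.val h2)))
  rw [h3, orderOf_one] at hz
  omega

/-- If `k` carries `p` to `τp`, then `k.swap * k` stabilizes `p`, so `k₂k₁ = k₁k₂ = w²` with `w`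
central. The pair `(w⁻¹, w⁻¹)` acts trivially, and correcting `k` by it makes the components
mutually inverse. -/
theorem FlatCover.exists_inv_pair_smul_eq_tau (hodd : Odd (Nat.card (Subgroup.center G)))
    {p : FlatCover S G} (hp : p.IsGeneric) (hfix : p.cls ∈ fixedLocus S G) :
    ∃ g : G, ((g, g⁻¹) : G × G) • p = p.tau := by
  obtain ⟨k, hk⟩ := FlatCover.cls_eq_cls_iff.1 (show p.tau.cls = p.cls from hfix)
  have h1 : (k.swap * k) • p = p := by
    rw [mul_smul, hk, ← FlatCover.tau_smul, hk]
    rfl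
  obtain ⟨h2, h3⟩ := ((FlatCover.isGeneric_iff p).1 hp _).1 h1
  change k.2 * k.1 = k.1 * k.2 at h2
  change k.2 * k.1 ∈ Subgroup.center G at h3
  obtain ⟨w, hw, hw2⟩ := exists_mul_self_of_odd hodd h3
  have hcw : ∀ u, u * w⁻¹ = w⁻¹ * u := Subgroup.mem_center_iff.1 (inv_mem hw)
  have h4 : ((w⁻¹, w⁻¹) : G × G) • p = p :=
    ((FlatCover.isGeneric_iff p).1 hp _).2 ⟨rfl, inv_mem hw⟩
  refine ⟨k.1 * w⁻¹, ?_⟩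
  have h5 : (k.1 * w⁻¹)⁻¹ = k.2 * w⁻¹ := by
    rw [inv_eq_iff_mul_eq_one, mul_assoc, ← hcw, mul_assoc, ← mul_assoc, ← h2, ← hw2]
    group
  rw [h5, show ((k.1 * w⁻¹, k.2 * w⁻¹) : G × G) = k * (w⁻¹, w⁻¹) from rfl, mul_smul, h4, hk]

/-- Applying `(g, 1)` transports half of the way from `p` to `τp`, where the two halves coincide.
The explicit formula for `x` is what makes the inverse map smooth later. -/
theorem FlatCover.exists_pullback_eq {p : FlatCover S G} {g : G}
    (hg : ((g, g⁻¹) : G × G) • p = p.tau) :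
    ∃ x : FlatBase S G, x.1 = (p.1.2.1, g * p.1.1.2) ∧ x.pullback = ((g, 1) : G × G) • p := by
  have h1 : p.1.1.gauge g g⁻¹ = p.1.2 := congrArg (fun q : FlatCover S G => q.1.1) hg
  have h2 : ((g, 1) : G × G) • p = ⟨(p.1.1.gauge g 1, p.1.2.gauge 1 g), _⟩ := rfl
  have h3 : p.1.1.gauge g 1 = p.1.2.gauge 1 g := by
    rw [← h1, ← Holonomy.gauge_mul]; simp
  have h4 : (p.1.1.gauge g 1).FaceRel (p.1.1.gauge g 1) := by
    have := (((g, 1) : G × G) • p).2.1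
    change (p.1.1.gauge g 1).FaceRel (p.1.2.gauge 1 g) at this
    rwa [← h3] at this
  refine ⟨⟨p.1.1.gauge g 1, h4⟩, ?_, Subtype.ext (Prod.ext rfl h3)⟩
  rw [← h1]
  refine Prod.ext (funext fun i => ?_) ?_
  · rfl
  · change g * p.1.1.2 * 1⁻¹ = g * p.1.1.2
    simp

theorem naturalMap_injOn_of_odd (hodd : Odd (Nat.card (Subgroup.center G))) :
    Set.InjOn (naturalMap (S := S) (G := G)) (genericBase S G) := by
  rintro _ ⟨x, hx, rfl⟩ r _ h
  obtain ⟨z, hz, hz2, rfl⟩ := FlatBase.exists_twist_of_naturalMap_eq hx h.symm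
  have h1 : z = 1 := eq_one_of_mul_self_of_odd hodd hz hz2
  subst h1
  congr 1
  exact Subtype.ext (Prod.ext rfl (one_mul _).symm)

theorem exists_naturalMap_eq_of_odd (hodd : Odd (Nat.card (Subgroup.center G)))
    {q : fixedLocus S G} (hq : q ∈ genericFixed S G) :
    ∃ r ∈ genericBase S G, naturalMap r = q := by
  obtain ⟨p, hp, hpq⟩ := hq
  obtain ⟨g, hg⟩ := FlatCover.exists_inv_pair_smul_eq_tau hodd hp (hpq ▸ q.2)
  obtain ⟨x, -, hx⟩ := FlatCover.exists_pullback_eq hg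
  have h : naturalMap x.cls = q := by
    refine Subtype.ext ?_
    rw [naturalMap_cls, hx, ← hpq]
    exact FlatCover.cls_eq_cls_iff.2 ⟨_, rfl⟩
  refine ⟨x.cls, naturalMap_mem_genericFixed_iff.1 ?_, h⟩
  rw [h]
  exact ⟨p, hp, hpq⟩

end OddCenter

/-! ### Generic points from a pair with central centralizer -/

section Existence

variable {G : Type*} [Group G]

/-- The holonomies with `a` and `b` along the first handle and `d` along the additional loops. -/
def Holonomy.ofFirstHandle (S : NonorientableSurface) (a b c d : G) : Holonomy S G :=
  (Sum.elim (Sum.elim (fun i => if i.1 = 0 then a else 1) (fun i => if i.1 = 0 then b else 1))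
    (fun _ => d), c)

theorem Holonomy.commProd_ofFirstHandle {S : NonorientableSurface} (hS : 1 ≤ S.handles)
    (a b c d : G) : (Holonomy.ofFirstHandle S a b c d).commProd = a * b * a⁻¹ * b⁻¹ := by
  have key : ∀ (l : ℕ), 1 ≤ l → (List.ofFn fun i : Fin l =>
      (if i.1 = 0 then a else 1) * (if i.1 = 0 then b else 1) * (if i.1 = 0 then a else 1)⁻¹ *
        (if i.1 = 0 then b else 1)⁻¹).prod = a * b * a⁻¹ * b⁻¹ := by
    intro l hl
    obtain ⟨m, rfl⟩ := Nat.exists_eq_add_of_le' hl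
    simp [List.ofFn_succ, List.ofFn_const]
  exact key S.handles hS

/-- With all other handles trivial, the relation becomes `[a, b] = r²`, solved by `c = r` or by `c =
1`, `d = r`. A stabilizing pair has central first component by the condition on `a`, `b`, and the
arc `c` then forces both components to be equal. -/
theorem exists_generic_of_centralizer_le {S : NonorientableSurface} (hS : 1 ≤ S.handles) {a b r : G}
    (hab : ∀ g : G, g * a = a * g → g * b = b * g → g ∈ Subgroup.center G)
    (hr : r * r = a * b * a⁻¹ * b⁻¹) : (genericBase S G).Nonempty := by
  obtain ⟨c, d, h⟩ : ∃ c d : G, (Holonomy.ofFirstHandle S a b c d).FaceRel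
      (Holonomy.ofFirstHandle S a b c d) := by
    cases S with
    | projective l =>
      refine ⟨r, 1, ?_⟩
      change Holonomy.commProd _ = r * r
      rw [Holonomy.commProd_ofFirstHandle hS, hr]
    | klein l =>
      refine ⟨1, r, ?_⟩
      change Holonomy.commProd _ = 1 * r * 1⁻¹ * r
      rw [Holonomy.commProd_ofFirstHandle hS, one_mul, inv_one, mul_one, hr]
  refine ⟨FlatBase.cls ⟨_, h⟩, ⟨_, h⟩, ?_, rfl⟩
  rw [FlatCover.isGeneric_iff]
  intro k
  constructor
  · intro hk
    have h1 : ∀ i, k.1 * (Holonomy.ofFirstHandle S a b c d).1 i * k.1⁻¹ =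
      (Holonomy.ofFirstHandle S a b c d).1 i := fun i => congrArg (fun p : FlatCover S G => p.1.1.1 i) hk
    have h2 : k.1 * c * k.2⁻¹ = c := congrArg (fun p : FlatCover S G => p.1.1.2) hk
    have ha : k.1 * a * k.1⁻¹ = a := h1 (Sum.inl (Sum.inl ⟨0, hS⟩))
    have hb : k.1 * b * k.1⁻¹ = b := h1 (Sum.inl (Sum.inr ⟨0, hS⟩))
    rw [mul_inv_eq_iff_eq_mul] at ha hb h2
    have hc := hab _ ha hb
    refine ⟨?_, hc⟩
    rw [← Subgroup.mem_center_iff.1 hc, mul_right_inj] at h2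
    exact h2
  · rintro ⟨h1, h2⟩
    obtain ⟨k1, k2⟩ := k
    simp only at h1 h2
    subst h1
    have hc : ∀ u, k1 * u * k1⁻¹ = u := fun u => by
      rw [← Subgroup.mem_center_iff.1 h2, mul_inv_cancel_right]
    exact Subtype.ext (Prod.ext (Prod.ext (funext fun i => hc _) (hc _))
      (Prod.ext (funext fun i => hc _) (hc _)))

end Existence

/-! ### Topology of the moduli spaces -/

section ModuliTopology

open Topology

variable (S : NonorientableSurface) (G : Type*) [Group G] [TopologicalSpace G]
  [IsTopologicalGroup G]

theorem Holonomy.continuous_commProd : Continuous (Holonomy.commProd : Holonomy S G → G) := by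
  have key : ∀ (l : ℕ) (f : Fin l → Holonomy S G → G), (∀ i, Continuous (f i)) →
      Continuous fun x => (List.ofFn fun i => f i x).prod := by
    intro l
    induction l with
    | zero => intro f _; simpa using continuous_const
    | succ l ih =>
      intro f hf
      simp only [List.ofFn_succ, List.prod_cons]
      exact (hf 0).mul (ih _ fun i => hf _)
  refine key _ (fun i x => x.a i * x.b i * (x.a i)⁻¹ * (x.b i)⁻¹) fun i => ?_
  unfold Holonomy.a Holonomy.b
  fun_prop

theorem Holonomy.isClosed_faceRel [T2Space G] :
    IsClosed {p : Holonomy S G × Holonomy S G | p.1.FaceRel p.2} := by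
  cases S with
  | projective l =>
    refine isClosed_eq ((Holonomy.continuous_commProd _ G).comp continuous_fst) ?_
    unfold Holonomy.c
    fun_prop
  | klein l =>
    refine isClosed_eq ((Holonomy.continuous_commProd _ G).comp continuous_fst) ?_
    unfold Holonomy.c Holonomy.d
    fun_prop

instance [CompactSpace G] [T2Space G] : CompactSpace (FlatBase S G) :=
  isCompact_iff_compactSpace.1
    (((Holonomy.isClosed_faceRel S G).preimage
      (continuous_id.prodMk continuous_id)).isCompact)

instance [T2Space G] : T2Space (FlatCover S G) :=
  inferInstanceAs (T2Space
    {p : Holonomy S G × Holonomy S G // p.1.FaceRel p.2 ∧ p.2.FaceRel p.1})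

theorem Holonomy.continuous_gauge :
    Continuous fun q : G × G × Holonomy S G => Holonomy.gauge q.1 q.2.1 q.2.2 := by
  unfold Holonomy.gauge
  fun_prop

instance : ContinuousSMul (G × G) (FlatCover S G) where
  continuous_smul := by
    refine Continuous.subtype_mk (Continuous.prodMk ?_ ?_) _
    · exact (Holonomy.continuous_gauge S G).comp (continuous_fst.fst.prodMk
        (continuous_fst.snd.prodMk (continuous_subtype_val.comp continuous_snd).fst))
    · exact (Holonomy.continuous_gauge S G).comp (continuous_fst.snd.prodMk
        (continuous_fst.fst.prodMk (continuous_subtype_val.comp continuous_snd).snd))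

/-- A continuous action of a compact group on a Hausdorff space is proper. -/
theorem properSMul_of_compactSpace {K X : Type*} [Group K] [TopologicalSpace K] [CompactSpace K]
    [TopologicalSpace X] [T2Space X] [MulAction K X] [ContinuousSMul K X] : ProperSMul K X := by
  rw [properSMul_iff_continuousSMul_ultrafilter_tendsto_t2]
  refine ⟨inferInstance, fun 𝒰 _ _ _ => ?_⟩
  obtain ⟨g, -, hg⟩ := isCompact_univ.ultrafilter_le_nhds (𝒰.map Prod.fst) (by simp)
  exact ⟨g, hg⟩

theorem t2Space_moduliCover [CompactSpace G] [T2Space G] : T2Space (ModuliCover S G) := by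
  have : ProperSMul (G × G) (FlatCover S G) := properSMul_of_compactSpace
  exact t2Space_quotient_mulAction_of_properSMul

theorem continuous_naturalMap : Continuous (naturalMap : ModuliBase S G → fixedLocus S G) := by
  refine Continuous.quotient_lift (Continuous.subtype_mk ?_ _) _
  refine continuous_quotient_mk'.comp ?_
  exact Continuous.subtype_mk (continuous_subtype_val.prodMk continuous_subtype_val) _

theorem isClosedMap_naturalMap [CompactSpace G] [T2Space G] :
    IsClosedMap (naturalMap : ModuliBase S G → fixedLocus S G) := by
  have := t2Space_moduliCover S G
  have : CompactSpace (ModuliBase S G) :=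
    inferInstanceAs (CompactSpace (Quotient (MulAction.orbitRel G (FlatBase S G))))
  exact (continuous_naturalMap S G).isClosedMap

theorem exists_homeomorph_of_odd [CompactSpace G] [T2Space G]
    (hodd : Odd (Nat.card (Subgroup.center G))) :
    ∃ φ : genericBase S G ≃ₜ genericFixed S G,
      ∀ q : genericBase S G, (φ q : fixedLocus S G) = naturalMap q.1 := by
  let f : genericBase S G → genericFixed S G := fun q =>
    ⟨naturalMap q.1, naturalMap_mem_genericFixed_iff.2 q.2⟩
  have hf : Continuous f :=
    ((continuous_naturalMap S G).comp continuous_subtype_val).subtype_mk _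
  have hbij : Function.Bijective f := by
    refine ⟨fun q r h => Subtype.ext (naturalMap_injOn_of_odd hodd q.2 r.2
      (congrArg Subtype.val h)), fun q => ?_⟩
    obtain ⟨r, hr, hrq⟩ := exists_naturalMap_eq_of_odd hodd q.2
    exact ⟨⟨r, hr⟩, Subtype.ext hrq⟩
  -- The smooth part of the source is the full preimage of that of the target, so closedness passes
  -- to the restriction.
  have hclosed : IsClosedMap f := by
    intro C hC
    obtain ⟨C', hC', rfl⟩ := isClosed_induced_iff.1 hC
    refine isClosed_induced_iff.2 ⟨naturalMap '' C', isClosedMap_naturalMap S G _ hC', ?_⟩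
    ext q
    constructor
    · rintro ⟨r, hr, hrq⟩
      exact ⟨⟨r, naturalMap_mem_genericFixed_iff.1 (hrq ▸ q.2)⟩, hr, Subtype.ext hrq⟩
    · rintro ⟨r, hr, rfl⟩
      exact ⟨r.1, hr, rfl⟩
  exact ⟨(Equiv.ofBijective f hbij).toHomeomorphOfContinuousClosed hf hclosed, fun q => rfl⟩

end ModuliTopology

/-! ### Implicit functions that are smooth on a neighbourhood -/

section ImplicitFunction

open Set Filter Topology

variable {Q X F : Type*} [NormedAddCommGroup Q] [NormedSpace ℝ Q] [CompleteSpace Q]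
  [NormedAddCommGroup X] [NormedSpace ℝ X] [CompleteSpace X]

/-- Smoothness at nearby parameters comes from the implicit functions based at nearby points of the
graph, which agree with `s` locally by uniqueness. -/
theorem exists_eventually_contDiffAt_eq_of_isInvertible {f : Q × X → X} {u : Q × X}
    (hf : ∀ᶠ z in 𝓝 u, ContDiffAt ℝ ∞ f z)
    (hu : (fderiv ℝ f u ∘L .inr ℝ Q X).IsInvertible) :
    ∃ s : Q → X, (∀ᶠ v in 𝓝 u.1, ContDiffAt ℝ ∞ s v) ∧
      ∀ᶠ z in 𝓝 u, f z = f u → s z.1 = z.2 := by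
  have hn : (∞ : WithTop ℕ∞) ≠ 0 := by simp
  set s := hf.self_of_nhds.implicitFunction hn hu with hs
  have hiff := hf.self_of_nhds.eventually_apply_eq_iff_implicitFunction hn hu
  refine ⟨s, ?_, hiff.mono fun z hz => hz.1⟩
  have hcont : ContinuousAt (fun z => fderiv ℝ f z ∘L .inr ℝ Q X) u :=
    ((hf.self_of_nhds.fderiv_right (m := 0) (by simp)).continuousAt).clm_comp continuousAt_const
  have hinv : ∀ᶠ z in 𝓝 u, (fderiv ℝ f z ∘L .inr ℝ Q X).IsInvertible := by
    obtain ⟨e, he⟩ := hu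
    have hmem := e.nhds
    rw [he] at hmem
    filter_upwards [hcont hmem] with z hz using hz
  have hgraph : Tendsto (fun v => (v, s v)) (𝓝 u.1) (𝓝 u) := by
    have h1 : ContinuousAt s u.1 :=
      (hf.self_of_nhds.contDiffAt_implicitFunction hn hu).continuousAt
    have h2 := continuousAt_id.prodMk h1
    have h3 : s u.1 = u.2 := hf.self_of_nhds.implicitFunction_apply_self hn hu
    simpa [ContinuousAt, h3] using h2
  have hval := hf.self_of_nhds.eventually_apply_implicitFunction hn hu
  filter_upwards [hgraph.eventually hf, hgraph.eventually hinv,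
    hgraph.eventually hiff.eventually_nhds, hval] with v hfv hinvv hiffv hvalv
  have hc := hfv.contDiffAt_implicitFunction hn hinvv
  refine hc.congr_of_eventuallyEq ?_
  have h3 : hfv.implicitFunction hn hinvv v = s v := hfv.implicitFunction_apply_self hn hinvv
  have hgraph' : Tendsto (fun w => (w, hfv.implicitFunction hn hinvv w)) (𝓝 v) (𝓝 (v, s v)) := by
    have h2 := continuousAt_id.prodMk hc.continuousAt
    simpa [ContinuousAt, h3] using h2
  filter_upwards [hgraph'.eventually hiffv,
    hfv.eventually_apply_implicitFunction hn hinvv] with w hw hw'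
  exact hw.1 (hw'.trans hvalv)

/-- The implicit function theorem for overdetermined equations. -/
theorem exists_eventually_contDiffAt_eq_of_injective [NormedAddCommGroup F]
    [NormedSpace ℝ F] [FiniteDimensional ℝ F] {f : Q × X → F} {u : Q × X}
    (hf : ∀ᶠ z in 𝓝 u, ContDiffAt ℝ ∞ f z)
    (hu : ∀ ζ : X, fderiv ℝ f u (0, ζ) = 0 → ζ = 0) :
    ∃ s : Q → X, (∀ᶠ v in 𝓝 u.1, ContDiffAt ℝ ∞ s v) ∧
      ∀ᶠ z in 𝓝 u, f z = f u → s z.1 = z.2 := by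
  -- A linear left inverse of the partial derivative selects enough equations to make the system
  -- square.
  obtain ⟨L₀, hL₀⟩ := (fderiv ℝ f u ∘L .inr ℝ Q X).toLinearMap.exists_leftInverse_of_injective
    (LinearMap.ker_eq_bot'.2 fun ζ hζ => hu ζ (by simpa using hζ))
  let L : F →L[ℝ] X := LinearMap.toContinuousLinearMap L₀
  have hL : L ∘L (fderiv ℝ f u ∘L .inr ℝ Q X) = .id ℝ X :=
    ContinuousLinearMap.ext fun ζ => LinearMap.congr_fun hL₀ ζ
  have hd : fderiv ℝ (L ∘ f) u = L ∘L fderiv ℝ f u :=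
    (L.hasFDerivAt.comp u (hf.self_of_nhds.differentiableAt (by simp)).hasFDerivAt).fderiv
  obtain ⟨s, hs, hs'⟩ := exists_eventually_contDiffAt_eq_of_isInvertible (f := L ∘ f) (u := u)
    (hf.mono fun z hz => L.contDiff.contDiffAt.comp z hz)
    (by
      rw [hd, ContinuousLinearMap.comp_assoc, hL]
      exact ⟨ContinuousLinearEquiv.refl ℝ X, rfl⟩)
  exact ⟨s, hs, hs'.mono fun z hz h => hz (congrArg L h)⟩

end ImplicitFunction

/-! ### Orbit maps with locally trivial stabilizer are immersions at `1` -/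

section OrbitMaps

open Set Filter Topology

/-- By equivariance the left-invariant field of `ζ` is killed by all `o j` everywhere. The `o j` are
thus constant along its integral curve through `1`, which therefore stays at `1`; its velocity there
is `ζ`. -/
theorem eq_zero_of_mfderiv_eq_zero_of_equivariant {E H K E' H' M ι : Type*} [Finite ι]
    [NormedAddCommGroup E] [NormedSpace ℝ E] [CompleteSpace E] [TopologicalSpace H]
    (I : ModelWithCorners ℝ E H) [I.Boundaryless]
    [Group K] [TopologicalSpace K] [ChartedSpace H K] [LieGroup I ∞ K]
    [NormedAddCommGroup E'] [NormedSpace ℝ E'] [TopologicalSpace H'] (J : ModelWithCorners ℝ E' H')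
    [TopologicalSpace M] [ChartedSpace H' M] [IsManifold J ∞ M]
    {o : ι → K → M} (ho : ∀ j, MDifferentiable I J (o j))
    (heq : ∀ j k, ∃ T : M → M, MDifferentiable J J T ∧ ∀ l, o j (k * l) = T (o j l))
    (hst : ∀ᶠ k in 𝓝 (1 : K), (∀ j, o j k = o j 1) → k = 1)
    {ζ : E} (hζ : ∀ j, mfderiv I J (o j) 1 ζ = (0 : E')) : ζ = 0 := by
  have : LieGroup I (minSmoothness ℝ 3) K := LieGroup.of_le (n := ∞) ENat.LEInfty.out
  have : IsManifold I 1 K := IsManifold.of_le (n := ∞) (by simp)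
  let X : (k : K) → TangentSpace I k := mulInvariantVectorField (I := I) (G := K) ζ
  have hX : ∀ j k, mfderiv I J (o j) k (X k) = (0 : E') := by
    intro j k
    obtain ⟨T, hT, hoT⟩ := heq j k
    have hL : MDifferentiableAt I I (fun l : K => k * l) 1 :=
      (contMDiff_mul_left (I := I) (n := ∞) (a := k)).mdifferentiable (by simp) 1
    have h1 : HasMFDerivAt I J (o j ∘ fun l : K => k * l) 1
        ((mfderiv I J (o j) k).comp (mfderiv I I (fun l : K => k * l) 1)) := by
      have h0 : ∀ k', k' = k → HasMFDerivAt I J (o j) k' (mfderiv I J (o j) k : E →L[ℝ] E') := by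
        rintro k' rfl
        exact (ho j k').hasMFDerivAt
      exact (h0 _ (mul_one k)).comp 1 hL.hasMFDerivAt
    have h2 := (hT (o j 1)).hasMFDerivAt.comp 1 (ho j 1).hasMFDerivAt
    have h3 : (o j ∘ fun l : K => k * l) = T ∘ o j := funext fun l => hoT l
    rw [h3] at h1
    have h4 := h1.mfderiv.symm.trans h2.mfderiv
    have h5 := DFunLike.congr_fun h4 ζ
    refine h5.trans ?_
    exact (congrArg (mfderiv J J T (o j 1)) (hζ j)).trans (map_zero _)
  obtain ⟨γ, hγ0, hγ⟩ := exists_isMIntegralCurveAt_of_contMDiffAt_boundaryless (I := I)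
    (v := X) (x₀ := (1 : K)) 0
    ((contMDiff_mulInvariantVectorField (I := I) (G := K) ζ).contMDiffAt.of_le (by
      rw [minSmoothness_of_isRCLikeNormedField]
      exact one_le_two))
  have hconst : ∀ j, ∀ᶠ t in 𝓝 (0 : ℝ), o j (γ t) = o j 1 := by
    intro j
    have := eventually_eq_of_eventually_hasMFDerivAt_zero 𝓘(ℝ, ℝ) J (f := o j ∘ γ) (x := (0 : ℝ)) ?_
    · simpa [hγ0] using this
    · filter_upwards [hγ] with t ht
      refine ((ho j (γ t)).hasMFDerivAt.comp t ht).congr_mfderiv ?_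
      refine ContinuousLinearMap.ext fun (r : ℝ) => ?_
      change (mfderiv I J (o j) (γ t) : E →L[ℝ] E') ((r • (X (γ t) : E) : E)) = 0
      rw [map_smul]
      exact (congrArg (fun w : E' => r • w) (hX j (γ t))).trans (smul_zero (A := E') r)
  have hγc : Tendsto γ (𝓝 0) (𝓝 1) := hγ0 ▸ hγ.continuousAt
  have h1 : ∀ᶠ t in 𝓝 (0 : ℝ), γ t = 1 := by
    have hst' := hγc.eventually hst
    filter_upwards [hst', eventually_all.2 hconst] with t h1 h2 using h1 h2
  have h2 := hγ.self_of_nhds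
  have h3 : HasMFDerivAt 𝓘(ℝ, ℝ) I γ 0 (0 : ℝ →L[ℝ] E) :=
    (hasMFDerivAt_const (I := 𝓘(ℝ, ℝ)) (I' := I) (1 : K) (0 : ℝ)).congr_of_eventuallyEq h1
  have h4 : ((1 : ℝ →L[ℝ] ℝ).smulRight (X (γ 0) : E)) = 0 := h2.mfderiv.symm.trans h3.mfderiv
  have h5 : (X (γ 0) : E) = 0 := by
    have := DFunLike.congr_fun h4 (1 : ℝ)
    simpa using this
  have h6 : ∀ k : K, k = 1 → (X k : E) = ζ := by
    rintro k rfl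
    have hone : HasMFDerivAt I I (fun l : K => 1 * l) 1 (.id ℝ E) :=
      (hasMFDerivAt_id (I := I) (1 : K)).congr_of_eventuallyEq (.of_forall fun l => one_mul l)
    exact DFunLike.congr_fun (hone.mfderiv) ζ
  exact (h6 _ hγ0).symm.trans h5

end OrbitMaps

/-! ### Smooth solutions of gauge equations on a two-vertex graph -/

section ArrowAction

open Set Filter Topology

/-- The component of a pair that is selected by a Boolean. -/
def Prod.side {G : Type*} (b : Bool) (k : G × G) : G := bif b then k.1 else k.2

/-- Gauge transformation of the holonomies along finitely many arrows between two points. -/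
def arrowGauge {G ι : Type*} [Group G] (s t : ι → Bool) (k : G × G) (a : ι → G) : ι → G :=
  fun j => k.side (s j) * a j * (k.side (t j))⁻¹

variable {E H G : Type*} [NormedAddCommGroup E] [NormedSpace ℝ E] [TopologicalSpace H]
  (I : ModelWithCorners ℝ E H) [Group G] [TopologicalSpace G] [ChartedSpace H G]

theorem Prod.contMDiff_side (b : Bool) :
    ContMDiff (I.prod I) I ∞ (Prod.side b : G × G → G) := by
  cases b
  exacts [contMDiff_snd, contMDiff_fst]

theorem Prod.side_mul (b : Bool) (k l : G × G) : (k * l).side b = k.side b * l.side b := by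
  cases b <;> rfl

variable [I.Boundaryless] [LieGroup I ∞ G] {ι : Type*} [Fintype ι] (s t : ι → Bool)
  (k₀ : G × G) (a₀ b₀ : ι → G)

/-- The discrepancy between `b` and the transform of `a`, in charts at `a₀`, `b₀` and `1`. -/
noncomputable def arrowDefect (z : ((ι → E) × (ι → E)) × (E × E)) (j : ι) : G :=
  (k₀ * (extChartAt (I.prod I) (1 : G × G)).symm z.2).side (s j) *
    (extChartAt I (a₀ j)).symm (z.1.1 j) *
    ((k₀ * (extChartAt (I.prod I) (1 : G × G)).symm z.2).side (t j))⁻¹ *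
    ((extChartAt I (b₀ j)).symm (z.1.2 j))⁻¹

/-- The coordinates of the base point of `arrowDefect`. -/
noncomputable def arrowBase : ((ι → E) × (ι → E)) × (E × E) :=
  ((fun j => extChartAt I (a₀ j) (a₀ j), fun j => extChartAt I (b₀ j) (b₀ j)),
    extChartAt (I.prod I) (1 : G × G) 1)

theorem contMDiffAt_extChartAt_symm_of_mem {M : Type*} [TopologicalSpace M] [ChartedSpace H M]
    [IsManifold I ∞ M] (x : M) {v : E} (hv : v ∈ (extChartAt I x).target) :
    ContMDiffAt 𝓘(ℝ, E) I ∞ (extChartAt I x).symm v :=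
  (contMDiffOn_extChartAt_symm x).contMDiffAt ((isOpen_extChartAt_target x).mem_nhds hv)

theorem eventually_contMDiffAt_arrowDefect (j : ι) :
    ∀ᶠ z in 𝓝 (arrowBase I a₀ b₀), ContMDiffAt 𝓘(ℝ, ((ι → E) × (ι → E)) × (E × E)) I ∞
      (fun z => arrowDefect I s t k₀ a₀ b₀ z j) z := by
  have h1 : ∀ᶠ z in 𝓝 (arrowBase I a₀ b₀), z.1.1 j ∈ (extChartAt I (a₀ j)).target :=
    (show Continuous fun z : ((ι → E) × (ι → E)) × (E × E) => z.1.1 j by fun_prop).continuousAt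
      (extChartAt_target_mem_nhds (I := I) (a₀ j))
  have h2 : ∀ᶠ z in 𝓝 (arrowBase I a₀ b₀), z.1.2 j ∈ (extChartAt I (b₀ j)).target :=
    (show Continuous fun z : ((ι → E) × (ι → E)) × (E × E) => z.1.2 j by fun_prop).continuousAt
      (extChartAt_target_mem_nhds (I := I) (b₀ j))
  have h3 : ∀ᶠ z in 𝓝 (arrowBase I a₀ b₀),
      z.2 ∈ (extChartAt (I.prod I) (1 : G × G)).target :=
    continuous_snd.continuousAt (extChartAt_target_mem_nhds (I := I.prod I) (1 : G × G))
  filter_upwards [h1, h2, h3] with z h1 h2 h3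
  have c1 : ContMDiffAt 𝓘(ℝ, ((ι → E) × (ι → E)) × (E × E)) I ∞
      (fun z : ((ι → E) × (ι → E)) × (E × E) => (extChartAt I (a₀ j)).symm (z.1.1 j)) z :=
    ContMDiffAt.comp (I' := 𝓘(ℝ, E)) z (contMDiffAt_extChartAt_symm_of_mem I (a₀ j) h1)
      (show ContDiff ℝ ∞ fun z : ((ι → E) × (ι → E)) × (E × E) => z.1.1 j by
        fun_prop).contMDiff.contMDiffAt
  have c2 : ContMDiffAt 𝓘(ℝ, ((ι → E) × (ι → E)) × (E × E)) I ∞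
      (fun z : ((ι → E) × (ι → E)) × (E × E) => (extChartAt I (b₀ j)).symm (z.1.2 j)) z :=
    ContMDiffAt.comp (I' := 𝓘(ℝ, E)) z (contMDiffAt_extChartAt_symm_of_mem I (b₀ j) h2)
      (show ContDiff ℝ ∞ fun z : ((ι → E) × (ι → E)) × (E × E) => z.1.2 j by
        fun_prop).contMDiff.contMDiffAt
  have c3 : ContMDiffAt 𝓘(ℝ, ((ι → E) × (ι → E)) × (E × E)) (I.prod I) ∞
      (fun z : ((ι → E) × (ι → E)) × (E × E) =>
        k₀ * (extChartAt (I.prod I) (1 : G × G)).symm z.2) z :=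
    contMDiffAt_const.mul (ContMDiffAt.comp (I' := 𝓘(ℝ, E × E)) z
      (contMDiffAt_extChartAt_symm_of_mem (I.prod I) (1 : G × G) h3)
      contDiff_snd.contMDiff.contMDiffAt)
  have c4 := fun b => ((Prod.contMDiff_side I b).contMDiffAt).comp z c3
  exact (((c4 (s j)).mul c1).mul (c4 (t j)).inv).mul c2.inv

theorem arrowGauge_extChartAt_symm (u : E × E) (j : ι) :
    arrowGauge s t ((extChartAt (I.prod I) (1 : G × G)).symm u) a₀ j =
      (k₀.side (s j))⁻¹ * arrowDefect I s t k₀ a₀ b₀ ((arrowBase I a₀ b₀).1, u) j *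
        (b₀ j * k₀.side (t j)) := by
  simp only [arrowGauge, arrowDefect, arrowBase, extChartAt_to_inv, Prod.side_mul]
  group

variable (h₀ : arrowGauge s t k₀ a₀ = b₀)
include h₀

theorem arrowDefect_arrowBase (j : ι) :
    arrowDefect I s t k₀ a₀ b₀ (arrowBase I a₀ b₀) j = 1 := by
  have := congrFun h₀ j
  simp only [arrowGauge] at this
  simp only [arrowDefect, arrowBase, extChartAt_to_inv, mul_one, this, mul_inv_cancel]

theorem eventually_contDiffAt_arrowDefect :
    ∀ᶠ z in 𝓝 (arrowBase I a₀ b₀), ContDiffAt ℝ ∞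
      (fun z j => extChartAt I (1 : G) (arrowDefect I s t k₀ a₀ b₀ z j)) z := by
  have h1 : ∀ j, ∀ᶠ z in 𝓝 (arrowBase I a₀ b₀),
      arrowDefect I s t k₀ a₀ b₀ z j ∈ (extChartAt I (1 : G)).source := fun j =>
    (eventually_contMDiffAt_arrowDefect I s t k₀ a₀ b₀ j).self_of_nhds.continuousAt
      (by simpa [arrowDefect_arrowBase I s t k₀ a₀ b₀ h₀] using
        extChartAt_source_mem_nhds (I := I) (1 : G))
  filter_upwards [eventually_all.2 h1,
    eventually_all.2 (eventually_contMDiffAt_arrowDefect I s t k₀ a₀ b₀)] with z hz hz'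
  refine contDiffAt_pi.2 fun j => ContMDiffAt.contDiffAt ?_
  exact (contMDiffAt_extChartAt' (by simpa using hz j)).comp z (hz' j)

/-- In the gauge variable the defect is an orbit map up to translations, so a kernel vector is a
tangent vector at `1` killed by all orbit maps of `a₀`; the locally trivial stabilizer excludes a
nonzero one. -/
theorem fderiv_arrowDefect_injective [CompleteSpace E]
    (hst : ∀ᶠ k in 𝓝 (1 : G × G), arrowGauge s t k a₀ = a₀ → k = 1) (ζ : E × E)
    (hζ : fderiv ℝ (fun z j => extChartAt I (1 : G) (arrowDefect I s t k₀ a₀ b₀ z j))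
      (arrowBase I a₀ b₀) (0, ζ) = 0) : ζ = 0 := by
  set u₀ := (arrowBase I a₀ b₀).2 with hu₀
  set Ψ := fun z j => extChartAt I (1 : G) (arrowDefect I s t k₀ a₀ b₀ z j) with hΨ
  let e := (extChartAt (I.prod I) (1 : G × G)).symm
  have he0 : e u₀ = 1 := extChartAt_to_inv (I := I.prod I) (1 : G × G)
  have he : HasMFDerivAt 𝓘(ℝ, E × E) (I.prod I) e u₀ (mfderiv 𝓘(ℝ, E × E) (I.prod I) e u₀) :=
    ((contMDiffAt_extChartAt_symm_self (I.prod I) (1 : G × G)).mdifferentiableAt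
      (by simp)).hasMFDerivAt
  have ho : ∀ j, MDifferentiable (I.prod I) I fun k : G × G => arrowGauge s t k a₀ j := fun j =>
    ((((Prod.contMDiff_side I (s j)).mul contMDiff_const).mul
      (Prod.contMDiff_side I (t j)).inv).mdifferentiable (by simp))
  have hzero : ∀ j, mfderiv (I.prod I) I (fun k : G × G => arrowGauge s t k a₀ j) 1
      (mfderiv 𝓘(ℝ, E × E) (I.prod I) e u₀ ζ) = (0 : E) := by
    intro j
    have hmem : arrowDefect I s t k₀ a₀ b₀ ((arrowBase I a₀ b₀).1, u₀) j = 1 :=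
      arrowDefect_arrowBase I s t k₀ a₀ b₀ h₀ j
    have hΨ' : HasFDerivAt (fun u : E × E => Ψ ((arrowBase I a₀ b₀).1, u) j)
        ((ContinuousLinearMap.proj (R := ℝ) (φ := fun _ : ι => E) j) ∘L
          (fderiv ℝ Ψ (arrowBase I a₀ b₀) ∘L .inr ℝ ((ι → E) × (ι → E)) (E × E))) u₀ :=
      (ContinuousLinearMap.proj (R := ℝ) (φ := fun _ : ι => E) j).hasFDerivAt.comp u₀
        (((eventually_contDiffAt_arrowDefect I s t k₀ a₀ b₀
          h₀).self_of_nhds.differentiableAt (by simp)).hasFDerivAt.comp u₀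
            (hasFDerivAt_prodMk_right _ u₀))
    have hR : MDifferentiableAt 𝓘(ℝ, E) I (fun v : E => (k₀.side (s j))⁻¹ *
        (extChartAt I (1 : G)).symm v * (b₀ j * k₀.side (t j)))
        (Ψ ((arrowBase I a₀ b₀).1, u₀) j) := by
      have h1 : Ψ ((arrowBase I a₀ b₀).1, u₀) j = extChartAt I (1 : G) 1 :=
        congrArg (extChartAt I (1 : G)) hmem
      rw [h1]
      exact ((contMDiffAt_const.mul (contMDiffAt_extChartAt_symm_self I (1 : G))).mul
        contMDiffAt_const).mdifferentiableAt (by simp)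
    have h1 := hR.hasMFDerivAt.comp u₀ hΨ'.hasMFDerivAt
    have h2 := (ho j (e u₀)).hasMFDerivAt.comp u₀ he
    have h3 : (fun k : G × G => arrowGauge s t k a₀ j) ∘ e =ᶠ[𝓝 u₀]
        (fun v : E => (k₀.side (s j))⁻¹ * (extChartAt I (1 : G)).symm v *
          (b₀ j * k₀.side (t j))) ∘ fun u : E × E => Ψ ((arrowBase I a₀ b₀).1, u) j := by
      have hc : ContinuousAt (fun u : E × E =>
          arrowDefect I s t k₀ a₀ b₀ ((arrowBase I a₀ b₀).1, u) j) u₀ :=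
        ContinuousAt.comp (f := fun u : E × E => ((arrowBase I a₀ b₀).1, u))
          (g := fun z => arrowDefect I s t k₀ a₀ b₀ z j)
          (eventually_contMDiffAt_arrowDefect I s t k₀ a₀ b₀ j).self_of_nhds.continuousAt
          (by fun_prop)
      filter_upwards [hc (show (extChartAt I (1 : G)).source ∈
        𝓝 (arrowDefect I s t k₀ a₀ b₀ ((arrowBase I a₀ b₀).1, u₀) j) by
          rw [hmem]; exact extChartAt_source_mem_nhds (I := I) (1 : G))] with u hu
      simp only [Function.comp_apply, hΨ, e]
      rw [(extChartAt I (1 : G)).left_inv hu, arrowGauge_extChartAt_symm I s t k₀ a₀ b₀ u j]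
    have h4 := DFunLike.congr_fun (h2.mfderiv.symm.trans
      (h1.congr_of_eventuallyEq h3).mfderiv) ζ
    have h5 : ∀ (k : G × G) (x : E × E), k = 1 →
        mfderiv (I.prod I) I (fun k : G × G => arrowGauge s t k a₀ j) k x = (0 : E) →
        mfderiv (I.prod I) I (fun k : G × G => arrowGauge s t k a₀ j) 1 x = (0 : E) := by
      rintro k x rfl h
      exact h
    refine h5 _ _ he0 (h4.trans ?_)
    refine (congrArg (mfderiv 𝓘(ℝ, E) I (fun v : E => (k₀.side (s j))⁻¹ *
        (extChartAt I (1 : G)).symm v * (b₀ j * k₀.side (t j)))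
        (Ψ ((arrowBase I a₀ b₀).1, u₀) j)) (a₂ := (0 : E)) ?_).trans (map_zero _)
    exact congrFun hζ j
  have hzero' : (mfderiv 𝓘(ℝ, E × E) (I.prod I) e u₀ ζ : E × E) = 0 := by
    refine eq_zero_of_mfderiv_eq_zero_of_equivariant (I.prod I) I
      (o := fun j k => arrowGauge s t k a₀ j) ho ?_ ?_ hzero
    · intro j k
      refine ⟨fun x => k.side (s j) * x * (k.side (t j))⁻¹,
        ((contMDiff_const.mul contMDiff_id).mul contMDiff_const).mdifferentiable (n := ∞)
          (by simp), fun l => ?_⟩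
      simp only [arrowGauge, Prod.side_mul]
      group
    · filter_upwards [hst] with k hk hk'
      refine hk (funext fun j => (hk' j).trans ?_)
      cases s j <;> cases t j <;> simp [arrowGauge, Prod.side]
  have hK : HasMFDerivAt (I.prod I) 𝓘(ℝ, E × E) (extChartAt (I.prod I) (1 : G × G)) (e u₀)
      (mfderiv (I.prod I) 𝓘(ℝ, E × E) (extChartAt (I.prod I) (1 : G × G)) (e u₀)) :=
    ((contMDiffAt_extChartAt' (n := ∞) (by
      rw [he0]; exact mem_chart_source _ _)).mdifferentiableAt (by simp)).hasMFDerivAt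
  have hid : HasMFDerivAt 𝓘(ℝ, E × E) 𝓘(ℝ, E × E) (extChartAt (I.prod I) (1 : G × G) ∘ e) u₀
      (.id ℝ (E × E)) := by
    refine (hasMFDerivAt_id (I := 𝓘(ℝ, E × E)) u₀).congr_of_eventuallyEq ?_
    filter_upwards [extChartAt_target_mem_nhds (I := I.prod I) (1 : G × G)] with u hu
    exact (extChartAt (I.prod I) (1 : G × G)).right_inv hu
  have hζ' := DFunLike.congr_fun (hid.mfderiv.symm.trans (hK.comp u₀ he).mfderiv) ζ
  refine Eq.trans hζ' ?_
  exact (congrArg (mfderiv (I.prod I) 𝓘(ℝ, E × E) (extChartAt (I.prod I) (1 : G × G)) (e u₀))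
    (a₂ := (0 : E × E)) hzero').trans (map_zero _)

/-- Solutions of gauge equations are smooth functions of the data. -/
theorem exists_contMDiffAt_eq_of_arrowGauge_eq [FiniteDimensional ℝ E] [CompleteSpace E]
    (hst : ∀ᶠ k in 𝓝 (1 : G × G), arrowGauge s t k a₀ = a₀ → k = 1)
    {E' H' N : Type*} [NormedAddCommGroup E'] [NormedSpace ℝ E'] [TopologicalSpace H']
    {J : ModelWithCorners ℝ E' H'} [TopologicalSpace N] [ChartedSpace H' N]
    {A B : ι → N → G} (hA : ∀ j, ContMDiff J I ∞ (A j)) (hB : ∀ j, ContMDiff J I ∞ (B j))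
    {p₀ : N} (hA₀ : ∀ j, A j p₀ = a₀ j) (hB₀ : ∀ j, B j p₀ = b₀ j) :
    ∃ σ : N → G × G, (∀ᶠ p in 𝓝 p₀, ContMDiffAt J (I.prod I) ∞ σ p) ∧
      ∀ᶠ q in 𝓝 (p₀, k₀), (arrowGauge s t q.2 fun j => A j q.1) = (fun j => B j q.1) →
        σ q.1 = q.2 := by
  have := topologicalGroup_of_lieGroup I ∞ (G := G)
  obtain ⟨r, hr, hr'⟩ := exists_eventually_contDiffAt_eq_of_injective
    (eventually_contDiffAt_arrowDefect I s t k₀ a₀ b₀ h₀)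
    (fderiv_arrowDefect_injective I s t k₀ a₀ b₀ h₀ hst)
  let e := extChartAt (I.prod I) (1 : G × G)
  let c : N → (ι → E) × (ι → E) := fun p =>
    (fun j => extChartAt I (a₀ j) (A j p), fun j => extChartAt I (b₀ j) (B j p))
  have hc₀ : c p₀ = (arrowBase I a₀ b₀).1 := by simp [c, arrowBase, hA₀, hB₀]
  have hAs : ∀ᶠ p in 𝓝 p₀, ∀ j, A j p ∈ (extChartAt I (a₀ j)).source :=
    eventually_all.2 fun j => (hA j).continuous.continuousAt (by
      rw [hA₀]; exact extChartAt_source_mem_nhds (I := I) (a₀ j))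
  have hBs : ∀ᶠ p in 𝓝 p₀, ∀ j, B j p ∈ (extChartAt I (b₀ j)).source :=
    eventually_all.2 fun j => (hB j).continuous.continuousAt (by
      rw [hB₀]; exact extChartAt_source_mem_nhds (I := I) (b₀ j))
  have hc : ∀ᶠ p in 𝓝 p₀, ContMDiffAt J 𝓘(ℝ, (ι → E) × (ι → E)) ∞ c p := by
    filter_upwards [hAs, hBs] with p hAp hBp
    refine (contMDiffAt_pi_space.2 fun j => ?_).prodMk_space (contMDiffAt_pi_space.2 fun j => ?_)
    · exact (contMDiffAt_extChartAt' (by simpa using hAp j)).comp p (hA j p)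
    · exact (contMDiffAt_extChartAt' (by simpa using hBp j)).comp p (hB j p)
  have hct : Tendsto c (𝓝 p₀) (𝓝 (arrowBase I a₀ b₀).1) :=
    hc₀ ▸ hc.self_of_nhds.continuousAt
  have hr₀ : r (arrowBase I a₀ b₀).1 = (arrowBase I a₀ b₀).2 := hr'.self_of_nhds rfl
  have hrt : Tendsto r (𝓝 (arrowBase I a₀ b₀).1) (𝓝 (arrowBase I a₀ b₀).2) :=
    hr₀ ▸ hr.self_of_nhds.continuousAt
  -- The implicit function gives the chart coordinates of `k₀⁻¹ k`.
  refine ⟨fun p => k₀ * e.symm (r (c p)), ?_, ?_⟩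
  · filter_upwards [hc, hct.eventually hr, (hrt.comp hct)
      (extChartAt_target_mem_nhds (I := I.prod I) (1 : G × G))] with p h1 h2 h3
    exact contMDiffAt_const.mul ((contMDiffAt_extChartAt_symm_of_mem (I.prod I) (1 : G × G) h3).comp
      p (h2.contMDiffAt.comp p h1))
  · have hk : Tendsto (fun q : N × (G × G) => k₀⁻¹ * q.2) (𝓝 (p₀, k₀)) (𝓝 1) := by
      have : ContinuousAt (fun q : N × (G × G) => k₀⁻¹ * q.2) (p₀, k₀) := by fun_prop
      simpa [ContinuousAt] using this
    have hek : Tendsto (fun q : N × (G × G) => e (k₀⁻¹ * q.2)) (𝓝 (p₀, k₀)) (𝓝 (e 1)) :=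
      (continuousAt_extChartAt (I := I.prod I) (1 : G × G)).tendsto.comp hk
    have hz : Tendsto (fun q : N × (G × G) => (c q.1, e (k₀⁻¹ * q.2))) (𝓝 (p₀, k₀))
        (𝓝 (arrowBase I a₀ b₀)) :=
      (hct.comp (continuous_fst.tendsto (p₀, k₀))).prodMk_nhds hek
    filter_upwards [hz.eventually hr', hk (extChartAt_source_mem_nhds (I := I.prod I) (1 : G × G)),
      (continuous_fst.tendsto (p₀, k₀)).eventually hAs,
      (continuous_fst.tendsto (p₀, k₀)).eventually hBs] with q h1 h2 h3 h4 h5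
    have h6 : ∀ j, arrowDefect I s t k₀ a₀ b₀ (c q.1, e (k₀⁻¹ * q.2)) j = 1 := fun j => by
      have h7 := congrFun h5 j
      simp only [arrowGauge] at h7
      simp only [arrowDefect, c]
      rw [e.left_inv h2, (extChartAt I (a₀ j)).left_inv (h3 j),
        (extChartAt I (b₀ j)).left_inv (h4 j), mul_inv_cancel_left, h7, mul_inv_cancel]
    have h8 : r (c q.1) = e (k₀⁻¹ * q.2) := by
      refine h1 (funext fun j => ?_)
      rw [h6, arrowDefect_arrowBase I s t k₀ a₀ b₀ h₀]
    change k₀ * e.symm (r (c q.1)) = q.2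
    rw [h8, e.left_inv h2, mul_inv_cancel_left]

end ArrowAction

/-! ### Coordinate projections of a finite power -/

section PiModel

open Set Filter Topology

theorem contMDiff_pi_apply {E H M ι : Type*} [Fintype ι] [NormedAddCommGroup E] [NormedSpace ℝ E]
    [TopologicalSpace H] (I : ModelWithCorners ℝ E H) [TopologicalSpace M] [ChartedSpace H M]
    (i : ι) : ContMDiff (ModelWithCorners.pi fun _ : ι => I) I ∞ fun V : ι → M => V i := by
  intro V
  rw [contMDiffAt_iff]
  refine ⟨(continuous_apply i).continuousAt, ?_⟩
  have hproj : ContDiffWithinAt ℝ ∞ (fun v : ι → E => v i)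
      (range (ModelWithCorners.pi fun _ : ι => I))
      (extChartAt (ModelWithCorners.pi fun _ : ι => I) V V) :=
    (contDiff_apply ℝ E i).contDiffWithinAt
  refine hproj.congr_of_eventuallyEq_of_mem ?_ (mem_range_self _)
  filter_upwards [extChartAt_target_mem_nhdsWithin (I := ModelWithCorners.pi fun _ : ι => I) V]
    with v hv
  have hv' : v i ∈ (extChartAt I (V i)).target := ⟨hv.1 i trivial, hv.2 i trivial⟩
  exact (extChartAt I (V i)).right_inv hv'

end PiModel

/-! ### Correspondence of smooth functions -/

section Smoothness

open Set Filter Topology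

variable {S : NonorientableSurface} {G : Type*} [Group G]

namespace Holonomy

/-- The holonomies of all loops and arcs, indexed by their starting point and their name. -/
def arrows (p : Holonomy S G × Holonomy S G) (j : Bool × Option S.LoopIndex) : G :=
  j.2.elim (p.side j.1).2 (p.side j.1).1

/-- The starting points of the loops and arcs. -/
def source (j : Bool × Option S.LoopIndex) : Bool := j.1

/-- The end points of the loops and arcs. -/
def target (j : Bool × Option S.LoopIndex) : Bool := j.2.elim (!j.1) fun _ => j.1

theorem arrowGauge_arrows (k : G × G) (p : Holonomy S G × Holonomy S G) :
    arrowGauge source target k (arrows p) = arrows (p.1.gauge k.1 k.2, p.2.gauge k.2 k.1) := by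
  funext ⟨b, o⟩
  cases b <;> cases o <;> rfl

theorem arrows_injective : Function.Injective (arrows (S := S) (G := G)) := by
  intro p q h
  refine Prod.ext (Prod.ext (funext fun i => ?_) ?_) (Prod.ext (funext fun i => ?_) ?_)
  · exact congrFun h (true, some i)
  · exact congrFun h (true, none)
  · exact congrFun h (false, some i)
  · exact congrFun h (false, none)

theorem arrowGauge_arrows_eq_iff (k : G × G) (p : FlatCover S G)
    (q : FlatCover S G) : arrowGauge source target k (arrows p.1) = arrows q.1 ↔ k • p = q := by
  rw [arrowGauge_arrows, arrows_injective.eq_iff]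
  exact ⟨fun h => Subtype.ext h, fun h => congrArg Subtype.val h⟩

theorem contMDiff_arrows {n : ℕ} [TopologicalSpace G] [ChartedSpace (EuclideanSpace ℝ (Fin n)) G]
    (j : Bool × Option S.LoopIndex) :
    ContMDiff ((holonomyModel n S).prod (holonomyModel n S)) (𝓡 n) ∞
      fun p : Holonomy S G × Holonomy S G => arrows p j := by
  obtain ⟨b, o⟩ := j
  have h1 : ContMDiff ((holonomyModel n S).prod (holonomyModel n S)) (holonomyModel n S) ∞
      fun p : Holonomy S G × Holonomy S G => p.side b := by
    cases b
    exacts [contMDiff_snd, contMDiff_fst]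
  cases o with
  | none => exact contMDiff_snd.comp h1
  | some i => exact (contMDiff_pi_apply (𝓡 n) i).comp (contMDiff_fst.comp h1)

end Holonomy

/-- Two solutions differ by a central `z`, and comparing the inverse components gives `z² = 1`. -/
theorem FlatCover.IsGeneric.inv_pair_unique (hodd : Odd (Nat.card (Subgroup.center G)))
    {p q : FlatCover S G} (hp : p.IsGeneric) {g h : G} (hg : ((g, g⁻¹) : G × G) • p = q)
    (hh : ((h, h⁻¹) : G × G) • p = q) : g = h := by
  have h1 : (((h, h⁻¹) : G × G)⁻¹ * (g, g⁻¹)) • p = p := by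
    rw [mul_smul, hg, ← hh, inv_smul_smul]
  obtain ⟨h2, h3⟩ := ((FlatCover.isGeneric_iff p).1 hp _).1 h1
  replace h2 : h⁻¹ * g = h * g⁻¹ := by simpa using h2
  replace h3 : h⁻¹ * g ∈ Subgroup.center G := by simpa using h3
  have h4 : g = h * (h⁻¹ * g) := by group
  set z := h⁻¹ * g
  have h5 : z * z = 1 := by
    nth_rw 1 [h2]
    rw [mul_assoc, Subgroup.mem_center_iff.1 h3, ← mul_assoc, ← h4, mul_inv_cancel]
  rw [h4, eq_one_of_mul_self_of_odd hodd h3 h5, mul_one]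

variable [TopologicalSpace G] {n : ℕ} [ChartedSpace (EuclideanSpace ℝ (Fin n)) G]
  [LieGroup (𝓡 n) ∞ G] [T2Space G] [CompactSpace G]

/-- The implicit function captures only solutions near `g₀`. Uniqueness at `p` excludes solutions
near any other `g`, and compactness of `G` combines these into one neighbourhood of `p`. -/
theorem exists_smooth_inv_pair [Finite (Subgroup.center G)]
    (hodd : Odd (Nat.card (Subgroup.center G))) {p : FlatCover S G} (hp : p.IsGeneric)
    {g₀ : G} (hg₀ : ((g₀, g₀⁻¹) : G × G) • p = p.tau) :
    ∃ σ : Holonomy S G × Holonomy S G → G × G,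
      (∀ᶠ q in 𝓝 p.1, ContMDiffAt ((holonomyModel n S).prod (holonomyModel n S))
        ((𝓡 n).prod (𝓡 n)) ∞ σ q) ∧ σ p.1 = (g₀, g₀⁻¹) ∧
      ∀ᶠ q in 𝓝 p.1, ∀ (r : FlatCover S G) (g : G), r.1 = q →
        ((g, g⁻¹) : G × G) • r = r.tau → σ q = (g, g⁻¹) := by
  have := topologicalGroup_of_lieGroup (𝓡 n) ∞ (G := G)
  have hst : ∀ᶠ k in 𝓝 (1 : G × G),
      arrowGauge Holonomy.source Holonomy.target k (Holonomy.arrows p.1) = Holonomy.arrows p.1 →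
        k = 1 := by
    -- The stabilizer is a copy of the finite center, so `1` is isolated in it.
    have hfin : {k : G × G | k • p = p ∧ k ≠ 1}.Finite := by
      refine ((Set.finite_range fun z : Subgroup.center G => ((z : G), (z : G))).subset ?_)
      rintro k ⟨hk, -⟩
      obtain ⟨h1, h2⟩ := ((FlatCover.isGeneric_iff p).1 hp k).1 hk
      exact ⟨⟨k.1, h2⟩, Prod.ext rfl h1⟩
    filter_upwards [hfin.isClosed.isOpen_compl.mem_nhds fun h => h.2 rfl] with k hk hk'
    by_contra hne
    exact hk ⟨(Holonomy.arrowGauge_arrows_eq_iff k p p).1 hk', hne⟩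
  obtain ⟨σ, hσ, hσ'⟩ := exists_contMDiffAt_eq_of_arrowGauge_eq (𝓡 n) Holonomy.source
    Holonomy.target (g₀, g₀⁻¹) (Holonomy.arrows p.1) (Holonomy.arrows p.tau.1)
    ((Holonomy.arrowGauge_arrows_eq_iff _ p p.tau).2 hg₀) hst
    (J := (holonomyModel n S).prod (holonomyModel n S))
    (A := fun j q => Holonomy.arrows q j) (B := fun j q => Holonomy.arrows q.swap j) (p₀ := p.1)
    Holonomy.contMDiff_arrows
    (fun j => (Holonomy.contMDiff_arrows j).comp (contMDiff_snd.prodMk contMDiff_fst))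
    (fun j => rfl) (fun j => rfl)
  refine ⟨σ, hσ, hσ'.self_of_nhds ((Holonomy.arrowGauge_arrows_eq_iff _ p p.tau).2 hg₀), ?_⟩
  have key : ∀ᶠ q in 𝓝 p.1, ∀ g ∈ (univ : Set G),
      arrowGauge Holonomy.source Holonomy.target (g, g⁻¹) (Holonomy.arrows q) =
        Holonomy.arrows q.swap → σ q = (g, g⁻¹) := by
    refine isCompact_univ.eventually_forall_of_forall_eventually fun g _ => ?_
    by_cases hg : g = g₀
    · subst hg
      have hc : ContinuousAt (fun r : (Holonomy S G × Holonomy S G) × G =>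
          (r.1, ((r.2, r.2⁻¹) : G × G))) (p.1, g) := by fun_prop
      exact hc.eventually hσ'
    · have hne : ¬ arrowGauge Holonomy.source Holonomy.target (g, g⁻¹) (Holonomy.arrows p.1) =
          Holonomy.arrows p.1.swap := fun h =>
        hg (hp.inv_pair_unique hodd ((Holonomy.arrowGauge_arrows_eq_iff _ p p.tau).1 h) hg₀)
      have harr : Continuous (Holonomy.arrows (S := S) (G := G)) :=
        continuous_pi fun j => (Holonomy.contMDiff_arrows (n := n) j).continuous
      have hc1 : Continuous fun r : (Holonomy S G × Holonomy S G) × G =>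
          arrowGauge Holonomy.source Holonomy.target (r.2, r.2⁻¹) (Holonomy.arrows r.1) := by
        have hside : ∀ b : Bool, Continuous fun r : (Holonomy S G × Holonomy S G) × G =>
            Prod.side b ((r.2, r.2⁻¹) : G × G) := by
          intro b
          cases b
          exacts [continuous_snd.inv, continuous_snd]
        exact continuous_pi fun j => ((hside _).mul
          ((continuous_apply j).comp (harr.comp continuous_fst))).mul (hside _).inv
      have hc2 : Continuous fun r : (Holonomy S G × Holonomy S G) × G =>
          Holonomy.arrows r.1.swap := harr.comp (continuous_swap.comp continuous_fst)
      have hopen := (isClosed_eq hc1 hc2).isOpen_compl.mem_nhds (x := (p.1, g)) hne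
      filter_upwards [hopen] with r hr hr'
      exact absurd hr' hr
  filter_upwards [key] with q hq r g hr hg
  subst hr
  exact hq g (mem_univ g) ((Holonomy.arrowGauge_arrows_eq_iff _ r r.tau).2 hg)

/-- Local extensions are pulled back along the diagonal in one direction, and along a smooth local
lift of the inverse of `φ` in the other. -/
theorem isSmoothFixed_iff_of_odd [Finite (Subgroup.center G)]
    (hodd : Odd (Nat.card (Subgroup.center G))) (φ : genericBase S G ≃ₜ genericFixed S G)
    (hφ : ∀ q : genericBase S G, (φ q : fixedLocus S G) = naturalMap q.1)
    (f : genericFixed S G → ℝ) : IsSmoothFixed n f ↔ IsSmoothBase n (f ∘ φ) := by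
  constructor
  · rintro hf ⟨x, hx, hxg⟩
    obtain ⟨U, F, hU, hxU, hF, hfF⟩ := hf ⟨(x, x), ⟨hx, hx⟩, rfl,
      naturalMap_mem_genericFixed_iff.2 hxg⟩
    have hd : ContMDiff (holonomyModel n S) ((holonomyModel n S).prod (holonomyModel n S)) ∞
        fun y : Holonomy S G => (y, y) := contMDiff_id.prodMk contMDiff_id
    refine ⟨(fun y => (y, y)) ⁻¹' U, fun y => F (y, y), hU.preimage hd.continuous, hxU,
      hF.comp hd.contMDiffOn fun y hy => hy, ?_⟩
    rintro ⟨y, hy, hyg⟩ hyU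
    refine Eq.trans ?_ (hfF ⟨(y, y), ⟨hy, hy⟩, rfl, naturalMap_mem_genericFixed_iff.2 hyg⟩ hyU)
    exact congrArg f (Subtype.ext (hφ _))
  · rintro hf ⟨p, hp, hfix, hpg⟩
    have hgen := (mem_genericFixed_iff hfix).1 hpg
    obtain ⟨g₀, hg₀⟩ := FlatCover.exists_inv_pair_smul_eq_tau hodd hgen hfix
    obtain ⟨σ, hσ, hσ₀, hσ'⟩ := exists_smooth_inv_pair (n := n) hodd hgen hg₀
    have key : ∀ (r : FlatCover S G) (hrfix : r.cls ∈ fixedLocus S G)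
        (hrg : ⟨r.cls, hrfix⟩ ∈ genericFixed S G) (g : G), ((g, g⁻¹) : G × G) • r = r.tau →
        ∃ (hx : Holonomy.FaceRel (r.1.2.1, g * r.1.1.2) (r.1.2.1, g * r.1.1.2))
          (hxg : FlatBase.cls ⟨(r.1.2.1, g * r.1.1.2), hx⟩ ∈ genericBase S G),
          φ ⟨_, hxg⟩ = ⟨⟨r.cls, hrfix⟩, hrg⟩ := by
      intro r hrfix hrg g hg
      obtain ⟨⟨x, hx⟩, hx1, hx2⟩ := FlatCover.exists_pullback_eq hg
      subst hx1
      have hxg : FlatBase.cls ⟨_, hx⟩ ∈ genericBase S G :=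
        cls_mem_genericBase_iff.2 (hx2 ▸ ((mem_genericFixed_iff hrfix).1 hrg).smul _)
      refine ⟨hx, hxg, Subtype.ext ((hφ _).trans (Subtype.ext ?_))⟩
      exact FlatCover.cls_eq_cls_iff.2 ⟨_, hx2.symm⟩
    obtain ⟨hx₀, hxg₀, -⟩ := key ⟨p, hp⟩ hfix hpg g₀ hg₀
    obtain ⟨U, F, hU, hxU, hF, hfF⟩ := hf ⟨_, hx₀, hxg₀⟩
    -- On generic flat tuples with fixed class this is the `x` of `FlatCover.exists_pullback_eq`,
    -- but it is defined and smooth on an open set of all tuples.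
    let ξ : Holonomy S G × Holonomy S G → Holonomy S G := fun q => (q.2.1, (σ q).1 * q.1.2)
    have hξ : ∀ᶠ q in 𝓝 p, ContMDiffAt ((holonomyModel n S).prod (holonomyModel n S))
        (holonomyModel n S) ∞ ξ q := by
      filter_upwards [hσ] with q hq
      exact (contMDiff_fst.comp contMDiff_snd).contMDiffAt.prodMk
        ((contMDiffAt_fst.comp q hq).mul (contMDiff_snd.comp contMDiff_fst).contMDiffAt)
    have hξ₀ : ξ p = (p.2.1, g₀ * p.1.2) := by simp only [ξ, hσ₀]
    have hξU : ∀ᶠ q in 𝓝 p, ξ q ∈ U :=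
      hξ.self_of_nhds.continuousAt (hU.mem_nhds (by rw [hξ₀]; exact hxU))
    obtain ⟨W, hW, hWo, hpW⟩ := eventually_nhds_iff.1 (hξ.and (hξU.and hσ'))
    refine ⟨W, F ∘ ξ, hWo, hpW, fun q hq => ?_, ?_⟩
    · obtain ⟨h1, h2, -⟩ := hW q hq
      exact ((hF.contMDiffAt (hU.mem_nhds h2)).comp q h1).contMDiffWithinAt
    · rintro ⟨q, h, hqfix, hqg⟩ hqW
      obtain ⟨-, h2, h3⟩ := hW q hqW
      obtain ⟨g, hg⟩ := FlatCover.exists_inv_pair_smul_eq_tau hodd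
        ((mem_genericFixed_iff hqfix).1 hqg) hqfix
      obtain ⟨hx, hxg, hφx⟩ := key ⟨q, h⟩ hqfix hqg g hg
      have hξq : ξ q = (q.2.1, g * q.1.2) := by simp only [ξ, h3 ⟨q, h⟩ g rfl hg]
      have h4 := hfF ⟨_, hx, hxg⟩ (show (q.2.1, g * q.1.2) ∈ U by
        rw [← hξq]; exact h2)
      refine Eq.trans ?_ (h4.trans (congrArg F hξq.symm))
      exact congrArg f hφx.symm

end Smoothness

/-! ### Generic points exist, and the final equivalence -/

section Main

open Set Filter Topology

theorem genericBase_nonempty {E H : Type*} [NormedAddCommGroup E] [NormedSpace ℝ E]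
    [TopologicalSpace H] [FiniteDimensional ℝ E] [CompleteSpace E] (I : ModelWithCorners ℝ E H)
    [I.Boundaryless] (G : Type*) [Group G] [TopologicalSpace G] [ChartedSpace H G]
    [LieGroup I ∞ G] [LieAlgebra.IsSemisimple ℝ (GroupLieAlgebra I G)]
    [CompactSpace G] [ConnectedSpace G] {S : NonorientableSurface} (hS : 1 ≤ S.handles) :
    (genericBase S G).Nonempty := by
  have := topologicalGroup_of_lieGroup I ∞ (G := G)
  have hc : ContinuousAt (fun k : G × G => k.1 * k.2 * k.1⁻¹ * k.2⁻¹) (1, 1) := by fun_prop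
  have h1 : ∀ᶠ k in 𝓝 ((1 : G), (1 : G)), ∃ r : G, r * r = k.1 * k.2 * k.1⁻¹ * k.2⁻¹ :=
    hc.eventually (by simpa using eventually_exists_mul_self_eq I G)
  rw [nhds_prod_eq] at h1
  -- On `U` all commutators are squares, so `a` and `b` only have to be chosen inside it.
  obtain ⟨U, hU, hUr⟩ := eventually_prod_self_iff'.1 h1
  obtain ⟨a, ha, b, hb, hab⟩ := exists_pair_centralizer_le_center I G hU
  obtain ⟨r, hr⟩ := hUr a ha b hb
  exact exists_generic_of_centralizer_le hS hab hr

/-- A generic class and its twist by a central `z` with `z² = 1` have the same image, so injectivity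
gives `z = 1`; by Cauchy's theorem the order is odd. -/
theorem odd_card_center_of_injOn_naturalMap {S : NonorientableSurface} {G : Type*} [Group G]
    [Finite (Subgroup.center G)] (hne : (genericBase S G).Nonempty)
    (hinj : InjOn (naturalMap : ModuliBase S G → fixedLocus S G) (genericBase S G)) :
    Odd (Nat.card (Subgroup.center G)) := by
  obtain ⟨_, x, hx, rfl⟩ := hne
  refine odd_card_center_of_forall fun z hz hz2 => ?_
  have hmem : ∀ (w : G) (hw : w ∈ Subgroup.center G) (hw2 : w * w = 1),
      (x.twist w hw hw2).cls ∈ genericBase S G := fun w hw hw2 => by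
    rw [← naturalMap_mem_genericFixed_iff, FlatBase.naturalMap_twist,
      naturalMap_mem_genericFixed_iff]
    exact cls_mem_genericBase_iff.2 hx
  have h1 := one_mem (Subgroup.center G)
  refine FlatBase.twist_cls_injective hx (hinj (hmem z hz hz2) (hmem 1 h1 (mul_one 1)) ?_)
  rw [FlatBase.naturalMap_twist, FlatBase.naturalMap_twist]

end Main

theorem mainTheorem1 (n : ℕ) (G : Type*) [Group G] [TopologicalSpace G]
    [ChartedSpace (EuclideanSpace ℝ (Fin n)) G] [LieGroup (𝓡 n) ∞ G]
    [T2Space G] [CompactSpace G] [ConnectedSpace G]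
    [LieAlgebra.IsSemisimple ℝ (GroupLieAlgebra (𝓡 n) G)]
    (S : NonorientableSurface) :
    Finite (Subgroup.center G) ∧
    (∀ q ∈ genericBase S G,
      (naturalMap ⁻¹' {naturalMap q}).ncard = Nat.card (Subgroup.center G ⧸ twoCenter G)) ∧
    (1 ≤ S.handles →
      (NaturalMapIsIsoOnSmoothParts n S G ↔ Odd (Nat.card (Subgroup.center G)))) := by
  have := topologicalGroup_of_lieGroup (𝓡 n) ∞ (G := G)
  have := finite_center (𝓡 n) G
  refine ⟨this, fun q hq => ncard_fiber_naturalMap hq, fun hS => ⟨?_, fun hodd => ?_⟩⟩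
  · rintro ⟨φ, hφ, -⟩
    refine odd_card_center_of_injOn_naturalMap (genericBase_nonempty (𝓡 n) G hS)
      fun q hq r hr hqr => ?_
    exact congrArg Subtype.val (φ.injective (a₁ := ⟨q, hq⟩) (a₂ := ⟨r, hr⟩)
      (Subtype.ext ((hφ ⟨q, hq⟩).trans (hqr.trans (hφ ⟨r, hr⟩).symm))))
  · obtain ⟨φ, hφ⟩ := exists_homeomorph_of_odd S G hodd
    exact ⟨φ, hφ, isSmoothFixed_iff_of_odd hodd φ hφ⟩
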